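/- Let $m\ge 1$ be an integer and $q\in(1,m+1]$. A $q$-expansion of a real number $x\in I_q:=[0,\frac{m}{q-1}]$ is a sequence $(c_i)_{i\ge1}\in\{0,1,\dots,m\}^{\mathbb N}$ with $x=\sum_{i=1}^{\infty}c_iq^{-i}$. A sequence is called infinite if it has no last nonzero digit (so $0^\infty$ is infinite), and $(c_i)$ is called doubly infinite if both $(c_i)$ and its reflection $(m-c_i)$ are infinite. Let $$\mathcal U_q=\{x\in I_q: x\text{ has a unique } q\text{-expansion}\},\qquad \mathcal V_q=\{x\in I_q: x\text{ has at most one doubly infinite } q\text{-expansion}\},$$ $$\mathcal B_2(m)=\{p\in(1,m+1]: \text{some } x\in I_p \text{ has exactly two different } p\text{-expansions}\},$$ and let $\mathcal G(m)$ be the generalized golden ratio, that is, $\mathcal G(m)=k+1$ if $m=2k$, and $\mathcal G(m)=\frac{k+1+\sqrt{k^2+6k+5}}{2}$ if $m=2k+1$. For $A\subseteq\mathbb R$ let $\overline A$ be its closure in $\mathbb R$ and $A-A=\{a-b:a,b\in A\}$. Then the following four conditions are equivalent: (i) $q\in\mathcal B_2(m)$; (ii) $1\in\mathcal U_q-\mathcal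 U_q$; (iii) $1\in\overline{\mathcal U_q}-\overline{\mathcal U_q}$; (iv) $1\in\mathcal V_q-\mathcal V_q$ and $q\ne\mathcal G(m)$. -/

import Mathlib

open Set
open scoped Pointwise

/-- The digit sequence `c` over `{0, …, m}` (indexed from `0`) is a `q`-expansion of `x`:
`x = ∑ i, c i / q ^ (i + 1)`. -/
def IsExpansion (m : ℕ) (q : ℝ) (c : ℕ → Fin (m + 1)) (x : ℝ) : Prop :=
  HasSum (fun i : ℕ => ((c i : ℕ) : ℝ) / q ^ (i + 1)) x

/-- The interval `I_q = [0, m / (q - 1)]`. -/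
noncomputable def baseInterval (m : ℕ) (q : ℝ) : Set ℝ :=
  Icc 0 ((m : ℝ) / (q - 1))

/-- A digit sequence is finite if it has a last nonzero digit, and infinite otherwise. -/
def IsInfinite {m : ℕ} (c : ℕ → Fin (m + 1)) : Prop :=
  ¬ ∃ n, c n ≠ 0 ∧ ∀ k, n < k → c k = 0

/-- The reflection `(m - c_i)` of the digit sequence `(c_i)`. -/
def reflection {m : ℕ} (c : ℕ → Fin (m + 1)) : ℕ → Fin (m + 1) :=
  fun i => Fin.rev (c i)

/-- A digit sequence is doubly infinite if both it and its reflection are infinite. -/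
def IsDoublyInfinite {m : ℕ} (c : ℕ → Fin (m + 1)) : Prop :=
  IsInfinite c ∧ IsInfinite (reflection c)

/-- The univoque set `U_q`: the points of `I_q` with a unique `q`-expansion. -/
def univoqueSet (m : ℕ) (q : ℝ) : Set ℝ :=
  {x | x ∈ baseInterval m q ∧ ∃! c : ℕ → Fin (m + 1), IsExpansion m q c x}

/-- The set `V_q`: the points of `I_q` with at most one doubly infinite `q`-expansion. -/
def doublySet (m : ℕ) (q : ℝ) : Set ℝ :=
  {x | x ∈ baseInterval m q ∧
    {c : ℕ → Fin (m + 1) | IsExpansion m q c x ∧ IsDoublyInfinite c}.Subsingleton}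

/-- The set `B₂(m)`: the bases `q ∈ (1, m + 1]` for which some point of `I_q` has exactly two
different `q`-expansions. -/
def basesTwo (m : ℕ) : Set ℝ :=
  {q | q ∈ Ioc (1 : ℝ) ((m : ℝ) + 1) ∧
    ∃ x ∈ baseInterval m q, {c : ℕ → Fin (m + 1) | IsExpansion m q c x}.encard = 2}

/-- The generalized golden ratio: `k + 1` if `m = 2 k`, and
`(k + 1 + √(k ^ 2 + 6 k + 5)) / 2` if `m = 2 k + 1`. The division `m / 2` is that of `ℕ`. -/
noncomputable def goldenRatioGen (m : ℕ) : ℝ :=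
  if Even m then ((m / 2 : ℕ) : ℝ) + 1
  else (((m / 2 : ℕ) : ℝ) + 1 +
    Real.sqrt (((m / 2 : ℕ) : ℝ) ^ 2 + 6 * ((m / 2 : ℕ) : ℝ) + 5)) / 2

/-! Write M = m/(q-1). Two expansions of a number that first differ by one digit step have tails
whose values differ by 1. If these are the only expansions, both tails are unique expansions.
Conversely, two unique expansions with values differing by 1 can be prefixed by 0 and 1. This gives
(i) ⇔ (ii) (`one_mem_sub_of_lt`, `mem_basesTwo_of_one_mem_univoque_sub`). (ii) ⇒ (iii) is trivial.
(iii) ⇒ (iv) holds because two distinct doubly infinite expansions survive small perturbations of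
the point, so closure(U_q) ⊆ V_q, and because at q = G(m) only 0 and M > 1 have unique expansions.
The weight lies in (iv) ⇒ (ii). If q = m+1, then 1 = M - 0. Otherwise a point of V_q outside U_q has
equal quasi-greedy and quasi-lazy expansions, and a tail of that expansion, or of its mirror image,
is an expansion `a` of 1 with admissible tails (`exists_expansion_one`). All tails of `a`, and all
mirrored proper tails, are lexicographically at most `a`. If none equals `a`, then 1 itself lies in
U_q and 1 = 1 - 0. If `a` has a period N, raise the last digit of its first period and continue by
some `w`: the result has value 1 plus that of `0^N w`. It remains to choose `w` so that both are
unique expansions. The periodic sequence `bumpedMirror` does this, both in the purely periodic case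
and when `a` is followed by its own mirror image; the excluded base G(m) is where the choice breaks
down. -/

/-! ### Integer digit sequences and operations on them -/

/-- The digits of `s` lie in `{0, …, m}`. -/
def IsDigits (m : ℕ) (s : ℕ → ℤ) : Prop := ∀ i, 0 ≤ s i ∧ s i ≤ m

/-- The number `∑ i, s i / q ^ (i + 1)`. -/
noncomputable def digitValue (q : ℝ) (s : ℕ → ℤ) : ℝ := ∑' i, (s i : ℝ) / q ^ (i + 1)

/-- The sequence `s` without its first `n` terms. -/
def shiftSeq (n : ℕ) (s : ℕ → ℤ) : ℕ → ℤ := fun i => s (n + i)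

/-- The sequence `(m - s_i)`. -/
def mirror (m : ℕ) (s : ℕ → ℤ) : ℕ → ℤ := fun i => (m : ℤ) - s i

/-- The sequence starting with the first `n` terms of `s` and continuing as `t`. -/
def appendSeq (n : ℕ) (s t : ℕ → ℤ) : ℕ → ℤ := fun i => if i < n then s i else t (i - n)

lemma toLex_lt_iff {s t : ℕ → ℤ} :
    toLex s < toLex t ↔ ∃ k, (∀ i < k, s i = t i) ∧ s k < t k := Iff.rfl

lemma exists_first_ne {s t : ℕ → ℤ} (h : s ≠ t) : ∃ k, (∀ i < k, s i = t i) ∧ s k ≠ t k := by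
  classical
  have h' : ∃ k, s k ≠ t k := Function.ne_iff.1 h
  exact ⟨Nat.find h', fun i hi => not_not.1 (Nat.find_min h' hi), Nat.find_spec h'⟩

lemma shiftSeq_zero (s : ℕ → ℤ) : shiftSeq 0 s = s := by funext i; simp [shiftSeq]

lemma shiftSeq_shiftSeq (a b : ℕ) (s : ℕ → ℤ) : shiftSeq a (shiftSeq b s) = shiftSeq (b + a) s := by
  funext i; simp [shiftSeq, add_assoc]

lemma mirror_mirror (m : ℕ) (s : ℕ → ℤ) : mirror m (mirror m s) = s := by
  funext i; simp [mirror]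

lemma shiftSeq_mirror (m n : ℕ) (s : ℕ → ℤ) :
    shiftSeq n (mirror m s) = mirror m (shiftSeq n s) := rfl

lemma shiftSeq_appendSeq (n : ℕ) (s t : ℕ → ℤ) : shiftSeq n (appendSeq n s t) = t := by
  funext i; simp [shiftSeq, appendSeq]

lemma appendSeq_of_lt {n i : ℕ} (s t : ℕ → ℤ) (h : i < n) : appendSeq n s t i = s i := by
  simp [appendSeq, h]

lemma appendSeq_shiftSeq (n : ℕ) (s : ℕ → ℤ) : appendSeq n s (shiftSeq n s) = s := by
  funext i
  by_cases h : i < n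
  · simp [appendSeq, h]
  · simp [appendSeq, shiftSeq, h, Nat.add_sub_cancel' (not_lt.1 h)]

lemma mirror_lt_iff {m : ℕ} {s t : ℕ → ℤ} :
    toLex (mirror m s) < toLex (mirror m t) ↔ toLex t < toLex s := by
  simp only [toLex_lt_iff, mirror]
  refine exists_congr fun k => and_congr (forall_congr' fun i => imp_congr_right fun _ => ?_) ?_
  · omega
  · omega

namespace IsDigits
variable {m : ℕ} {s t : ℕ → ℤ}

lemma shift (hs : IsDigits m s) (n : ℕ) : IsDigits m (shiftSeq n s) := fun i => hs (n + i)

lemma mirror (hs : IsDigits m s) : IsDigits m (mirror m s) := fun i => by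
  have := hs i; simp only [_root_.mirror]; omega

lemma append (hs : IsDigits m s) (ht : IsDigits m t) (n : ℕ) : IsDigits m (appendSeq n s t) :=
  fun i => by
    unfold appendSeq; split_ifs
    exacts [hs i, ht _]

lemma const {d : ℤ} (h0 : 0 ≤ d) (h1 : d ≤ m) : IsDigits m (fun _ => d) := fun _ => ⟨h0, h1⟩

lemma hasSum {q : ℝ} (hq : 1 < q) (hs : IsDigits m s) :
    HasSum (fun i => (s i : ℝ) / q ^ (i + 1)) (digitValue q s) := by
  refine Summable.hasSum ?_
  have hq0 : 0 < q := by linarith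
  have h1 : Summable fun i : ℕ => (m : ℝ) * q⁻¹ * (q⁻¹) ^ i :=
    (summable_geometric_of_lt_one (by positivity) (inv_lt_one_of_one_lt₀ hq)).mul_left _
  refine h1.of_nonneg_of_le (fun i => ?_) fun i => ?_
  · have : (0 : ℝ) ≤ s i := by exact_mod_cast (hs i).1
    positivity
  · have : (s i : ℝ) ≤ m := by exact_mod_cast (hs i).2
    calc (s i : ℝ) / q ^ (i + 1) ≤ m / q ^ (i + 1) := by gcongr
      _ = (m : ℝ) * q⁻¹ * (q⁻¹) ^ i := by rw [pow_succ, inv_pow]; field_simp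

end IsDigits

/-! ### Values of digit sequences and lexicographic criteria for uniqueness -/

section Value
variable {m : ℕ} {q : ℝ} {s t : ℕ → ℤ}

lemma digitValue_nonneg (hq : 1 < q) (hs : IsDigits m s) : 0 ≤ digitValue q s :=
  tsum_nonneg fun i => by
    have : (0 : ℝ) ≤ s i := by exact_mod_cast (hs i).1
    positivity

lemma mul_digitValue (hq : 1 < q) (hs : IsDigits m s) :
    q * digitValue q s = s 0 + digitValue q (shiftSeq 1 s) := by
  have hq0 : q ≠ 0 := by linarith
  have h := (hs.hasSum hq).summable.sum_add_tsum_nat_add 1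
  have h2 : ∑' i, (s (i + 1) : ℝ) / q ^ (i + 1 + 1) = q⁻¹ * digitValue q (shiftSeq 1 s) := by
    rw [digitValue, ← tsum_mul_left]
    refine tsum_congr fun i => ?_
    rw [shiftSeq, add_comm 1 i, pow_succ _ (i + 1)]; field_simp
  rw [h2] at h
  simp only [Finset.sum_range_one, zero_add, pow_one] at h
  rw [digitValue, ← h]; field_simp

lemma mul_digitValue_shift (hq : 1 < q) (hs : IsDigits m s) (n : ℕ) :
    q * digitValue q (shiftSeq n s) = s n + digitValue q (shiftSeq (n + 1) s) := by
  rw [mul_digitValue hq (hs.shift n), shiftSeq_shiftSeq]; rfl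

lemma digitValue_const (hq : 1 < q) {d : ℤ} (h0 : 0 ≤ d) (h1 : d ≤ m) :
    digitValue q (fun _ => d) = d / (q - 1) := by
  have h := mul_digitValue hq (IsDigits.const (m := m) h0 h1)
  have e : shiftSeq 1 (fun _ : ℕ => d) = fun _ => d := rfl
  rw [e] at h
  rw [eq_div_iff (by linarith)]; linarith

lemma digitValue_mirror (hq : 1 < q) (hs : IsDigits m s) :
    digitValue q (mirror m s) = m / (q - 1) - digitValue q s := by
  have hc := (IsDigits.const (m := m) (d := (m : ℤ)) (by positivity) le_rfl).hasSum hq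
  have := (hc.sub (hs.hasSum hq)).tsum_eq
  rw [digitValue_const (m := m) hq (by positivity) le_rfl] at this
  rw [digitValue]
  push_cast [mirror] at this ⊢
  rw [← this]
  refine tsum_congr fun i => by ring

lemma digitValue_le (hq : 1 < q) (hs : IsDigits m s) : digitValue q s ≤ m / (q - 1) := by
  have := digitValue_nonneg hq hs.mirror
  rw [digitValue_mirror hq hs] at this; linarith

/-- A common prefix cancels, and the rest is scaled by `q ^ k`. This identity and its successor
version underlie every comparison below. -/
lemma pow_mul_digitValue_sub (hq : 1 < q) (hs : IsDigits m s) (ht : IsDigits m t) {k : ℕ}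
    (h : ∀ i < k, s i = t i) :
    q ^ k * (digitValue q s - digitValue q t)
      = digitValue q (shiftSeq k s) - digitValue q (shiftSeq k t) := by
  induction k with
  | zero => simp [shiftSeq_zero]
  | succ k ih =>
    have h1 := ih fun i hi => h i (by omega)
    have h2 := mul_digitValue_shift hq hs k
    have h3 := mul_digitValue_shift hq ht k
    rw [h k (by omega)] at h2
    rw [pow_succ, mul_comm (q ^ k), mul_assoc, h1]; linarith

lemma pow_succ_mul_digitValue_sub (hq : 1 < q) (hs : IsDigits m s) (ht : IsDigits m t) {k : ℕ}
    (h : ∀ i < k, s i = t i) :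
    q ^ (k + 1) * (digitValue q s - digitValue q t)
      = s k - t k + digitValue q (shiftSeq (k + 1) s) - digitValue q (shiftSeq (k + 1) t) := by
  have h1 := pow_mul_digitValue_sub hq hs ht h
  have h2 := mul_digitValue_shift hq hs k
  have h3 := mul_digitValue_shift hq ht k
  rw [pow_succ, mul_comm (q ^ k), mul_assoc, h1]; linarith

lemma digitValue_pos (hq : 1 < q) (hs : IsDigits m s) {n : ℕ} (hn : s n ≠ 0) :
    0 < digitValue q s := by
  have hp : (0 : ℝ) < s n := by exact_mod_cast lt_of_le_of_ne (hs n).1 (Ne.symm hn)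
  refine (hs.hasSum hq).summable.tsum_pos (fun i => ?_) n (by positivity)
  have : (0 : ℝ) ≤ s i := by exact_mod_cast (hs i).1
  positivity

lemma digitValue_lt (hq : 1 < q) (hs : IsDigits m s) {n : ℕ} (hn : s n ≠ m) :
    digitValue q s < m / (q - 1) := by
  have := digitValue_pos hq hs.mirror (n := n) (by simp only [mirror]; omega)
  rw [digitValue_mirror hq hs] at this; linarith

/-- A bounded orbit of `T ↦ q T - s n` starts at the value of the digit sequence. -/
lemma digitValue_eq_of_orbit (hq : 1 < q) (hs : IsDigits m s) {T : ℕ → ℝ} {C : ℝ}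
    (h0 : ∀ n, 0 ≤ T n) (h1 : ∀ n, T n ≤ C) (hT : ∀ n, T (n + 1) = q * T n - s n) (n : ℕ) :
    T n = digitValue q (shiftSeq n s) := by
  have hq0 : 0 < q := by linarith
  -- The error is multiplied by `q` at each step yet stays bounded, so it vanishes.
  have key : ∀ k, q ^ k * (T n - digitValue q (shiftSeq n s))
      = T (n + k) - digitValue q (shiftSeq (n + k) s) := by
    intro k
    induction k with
    | zero => simp
    | succ k ih =>
      have h2 := mul_digitValue_shift hq hs (n + k)
      rw [pow_succ, mul_comm (q ^ k), mul_assoc, ih, ← add_assoc, hT]; linarith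
  by_contra hne
  have hpos : 0 < |T n - digitValue q (shiftSeq n s)| := abs_pos.2 (sub_ne_zero.2 hne)
  obtain ⟨k, hk⟩ := pow_unbounded_of_one_lt
    ((C + m / (q - 1)) / |T n - digitValue q (shiftSeq n s)|) hq
  rw [div_lt_iff₀ hpos, ← abs_of_pos (pow_pos hq0 k), ← abs_mul, key k] at hk
  have a1 := digitValue_nonneg hq (hs.shift (n + k))
  have a2 := digitValue_le hq (hs.shift (n + k))
  have a3 := h0 (n + k)
  have a4 := h1 (n + k)
  have : |T (n + k) - digitValue q (shiftSeq (n + k) s)| ≤ C + m / (q - 1) := by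
    rw [abs_le]; constructor <;> linarith
  linarith

lemma digitValue_appendSeq (hq : 1 < q) (hs : IsDigits m s) (ht : IsDigits m t) (n : ℕ) :
    q ^ n * (digitValue q (appendSeq n s t) - digitValue q s)
      = digitValue q t - digitValue q (shiftSeq n s) := by
  rw [pow_mul_digitValue_sub hq (hs.append ht n) hs fun i hi => appendSeq_of_lt s t hi,
    shiftSeq_appendSeq]

/-- `s` is the only digit sequence over `{0, …, m}` with its value. -/
def IsUniqueDigits (m : ℕ) (q : ℝ) (s : ℕ → ℤ) : Prop :=
  IsDigits m s ∧ ∀ t, IsDigits m t → digitValue q t = digitValue q s → t = s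

/-- At the first place where another expansion differs, a larger digit needs the tail of `s` to be
at least 1, and a smaller digit needs it to be at most M - 1. -/
lemma IsUniqueDigits.of_tails (hq : 1 < q) (hs : IsDigits m s)
    (h1 : ∀ n, s n < m → digitValue q (shiftSeq (n + 1) s) < 1)
    (h2 : ∀ n, 0 < s n → m / (q - 1) - 1 < digitValue q (shiftSeq (n + 1) s)) :
    IsUniqueDigits m q s := by
  refine ⟨hs, fun t ht hts => ?_⟩
  by_contra hne
  obtain ⟨k, hk, hkne⟩ := exists_first_ne hne
  have h := pow_succ_mul_digitValue_sub hq ht hs hk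
  rw [hts, sub_self, mul_zero] at h
  have hb := hs k
  have hb' := ht k
  have c1 := digitValue_nonneg hq (ht.shift (k + 1))
  have c2 := digitValue_le hq (ht.shift (k + 1))
  rcases lt_or_gt_of_ne hkne with hlt | hlt
  · have := h2 k (by omega)
    have c3 : (t k : ℝ) + 1 ≤ s k := by exact_mod_cast hlt
    linarith
  · have := h1 k (by omega)
    have c3 : (s k : ℝ) + 1 ≤ t k := by exact_mod_cast hlt
    linarith

/-- Parry's lexicographic criterion. -/
lemma digitValue_le_one_of_lex (hq : 1 < q) {a : ℕ → ℤ} (ha : IsDigits m a)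
    (ha1 : digitValue q a = 1) (hs : IsDigits m s)
    (h : ∀ n, s n < m → toLex (shiftSeq (n + 1) s) < toLex a) {n : ℕ} (hn : s n < m) :
    digitValue q (shiftSeq (n + 1) s) ≤ 1 := by
  -- At the first difference from `a` the digit of `s` is below a digit of `a`, hence below `m`, so
  -- the hypothesis applies again there. Any excess over 1 is thus multiplied by at least `q` from
  -- one such place to the next, which boundedness forbids.
  have step : ∀ n, s n < m → ∃ n', s n' < m ∧
      q * (digitValue q (shiftSeq (n + 1) s) - 1)
        ≤ max 0 (digitValue q (shiftSeq (n' + 1) s) - 1) := by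
    intro n hn
    obtain ⟨k, hk, hlt⟩ := toLex_lt_iff.1 (h n hn)
    have e := pow_succ_mul_digitValue_sub hq (hs.shift (n + 1)) ha hk
    rw [ha1, shiftSeq_shiftSeq] at e
    have hlt' : (shiftSeq (n + 1) s k : ℝ) + 1 ≤ a k := by exact_mod_cast hlt
    have ak := ha k
    have c1 := digitValue_nonneg hq (ha.shift (k + 1))
    refine ⟨n + 1 + k, lt_of_lt_of_le hlt ak.2, ?_⟩
    rw [← add_assoc] at e
    rcases le_total (digitValue q (shiftSeq (n + 1) s) - 1) 0 with h0 | h0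
    · exact le_max_of_le_left (by nlinarith)
    · refine le_max_of_le_right ?_
      have : q * (digitValue q (shiftSeq (n + 1) s) - 1)
          ≤ q ^ (k + 1) * (digitValue q (shiftSeq (n + 1) s) - 1) := by
        gcongr
        exact le_self_pow₀ hq.le (by omega)
      linarith
  by_contra hgt
  have iter : ∀ j : ℕ, ∃ n', s n' < m ∧ q ^ j * (digitValue q (shiftSeq (n + 1) s) - 1)
      ≤ digitValue q (shiftSeq (n' + 1) s) - 1 := by
    intro j
    induction j with
    | zero => exact ⟨n, hn, by simp⟩
    | succ j ih =>
      obtain ⟨n₁, hn₁, h1⟩ := ih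
      obtain ⟨n₂, hn₂, h2⟩ := step n₁ hn₁
      refine ⟨n₂, hn₂, ?_⟩
      have hpos : 0 < q ^ j * (digitValue q (shiftSeq (n + 1) s) - 1) :=
        mul_pos (pow_pos (by linarith) _) (by linarith)
      have hle : q * (q ^ j * (digitValue q (shiftSeq (n + 1) s) - 1))
          ≤ max 0 (digitValue q (shiftSeq (n₂ + 1) s) - 1) :=
        le_trans (by gcongr) h2
      rw [pow_succ, mul_comm (q ^ j), mul_assoc]
      rcases le_max_iff.1 hle with h3 | h3
      · nlinarith
      · exact h3
  have hpos : 0 < digitValue q (shiftSeq (n + 1) s) - 1 := by linarith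
  obtain ⟨j, hj⟩ := pow_unbounded_of_one_lt
    ((m / (q - 1)) / (digitValue q (shiftSeq (n + 1) s) - 1)) hq
  rw [div_lt_iff₀ hpos] at hj
  obtain ⟨n', -, h'⟩ := iter j
  have := digitValue_le hq (hs.shift (n' + 1))
  linarith

/-- Strictness comes from the positive tail of `a` after the first difference. -/
lemma digitValue_lt_one_of_lex (hq : 1 < q) {a : ℕ → ℤ} (ha : IsDigits m a)
    (ha1 : digitValue q a = 1) (hinf : ∀ n, 0 < digitValue q (shiftSeq n a)) (hs : IsDigits m s)
    (h : ∀ n, s n < m → toLex (shiftSeq (n + 1) s) < toLex a) {n : ℕ} (hn : s n < m) :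
    digitValue q (shiftSeq (n + 1) s) < 1 := by
  obtain ⟨k, hk, hlt⟩ := toLex_lt_iff.1 (h n hn)
  have e := pow_succ_mul_digitValue_sub hq (hs.shift (n + 1)) ha hk
  rw [ha1, shiftSeq_shiftSeq, ← add_assoc] at e
  have hlt' : (shiftSeq (n + 1) s k : ℝ) + 1 ≤ a k := by exact_mod_cast hlt
  have c1 := hinf (k + 1)
  have c2 := digitValue_le_one_of_lex hq ha ha1 hs h (n := n + 1 + k)
    (lt_of_lt_of_le hlt (ha k).2)
  by_contra hge
  have : 0 ≤ q ^ (k + 1) * (digitValue q (shiftSeq (n + 1) s) - 1) :=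
    mul_nonneg (pow_nonneg (by linarith) _) (by linarith)
  linarith

lemma IsUniqueDigits.of_lex (hq : 1 < q) {a : ℕ → ℤ} (ha : IsDigits m a)
    (ha1 : digitValue q a = 1) (hinf : ∀ n, 0 < digitValue q (shiftSeq n a)) (hs : IsDigits m s)
    (h1 : ∀ n, s n < m → toLex (shiftSeq (n + 1) s) < toLex a)
    (h2 : ∀ n, 0 < s n → toLex (mirror m (shiftSeq (n + 1) s)) < toLex a) :
    IsUniqueDigits m q s := by
  refine .of_tails hq hs (fun n hn => digitValue_lt_one_of_lex hq ha ha1 hinf hs h1 hn)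
    fun n hn => ?_
  have := digitValue_lt_one_of_lex hq ha ha1 hinf hs.mirror
    (fun n hn => h2 n (by simp only [mirror] at hn; omega)) (n := n)
    (by simp only [mirror]; omega)
  rw [shiftSeq_mirror, digitValue_mirror hq (hs.shift _)] at this
  linarith

/-- A sequence of value at most `1` with positive tails is lexicographically at most any expansion
of `1` with tails at most `1`. -/
lemma toLex_le_of_digitValue_le_one (hq : 1 < q) {a : ℕ → ℤ} (ha : IsDigits m a)
    (ha1 : digitValue q a = 1) (hle : ∀ n, digitValue q (shiftSeq n a) ≤ 1) (hs : IsDigits m s)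
    (hs1 : digitValue q s ≤ 1) (hinf : ∀ n, 0 < digitValue q (shiftSeq n s)) :
    toLex s ≤ toLex a := by
  by_contra hlt
  obtain ⟨k, hk, hlt⟩ := toLex_lt_iff.1 (not_le.1 hlt)
  have e := pow_succ_mul_digitValue_sub hq hs ha (fun i hi => (hk i hi).symm)
  have c1 := hle (k + 1)
  have c2 := hinf (k + 1)
  have c3 : (a k : ℝ) + 1 ≤ s k := by exact_mod_cast hlt
  have c4 : q ^ (k + 1) * (digitValue q s - digitValue q a) ≤ 0 :=
    mul_nonpos_of_nonneg_of_nonpos (pow_nonneg (by linarith) _) (by linarith)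
  linarith

end Value

/-! ### Existence of expansions, rigidity of unique ones, and perturbation -/

section Expansions
variable {m : ℕ} {q : ℝ} {s t : ℕ → ℤ}

/-- The quasi-greedy expansion. -/
lemma exists_quasiGreedy (hq : 1 < q) (hqm : q ≤ m + 1) {y : ℝ} (h0 : 0 < y)
    (h1 : y ≤ m / (q - 1)) :
    ∃ s, IsDigits m s ∧ digitValue q s = y ∧ (∀ n, 0 < digitValue q (shiftSeq n s)) ∧
      ∀ n, s n < m → digitValue q (shiftSeq (n + 1) s) ≤ 1 := by
  have hq1 : 0 < q - 1 := by linarith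
  -- The largest admissible digit that leaves a strictly positive remainder.
  let d : ℝ → ℤ := fun x => min (m : ℤ) (⌈q * x⌉ - 1)
  let T : ℕ → ℝ := fun n => (fun x => q * x - d x)^[n] y
  have hT : ∀ n, T (n + 1) = q * T n - d (T n) := fun n =>
    Function.iterate_succ_apply' (fun x => q * x - d x) n y
  have hM1 : 1 ≤ m / (q - 1) := by rw [le_div_iff₀ hq1]; linarith
  have hMM : q * (m / (q - 1)) - m = m / (q - 1) := by field_simp; ring
  have step : ∀ x : ℝ, 0 < x → x ≤ m / (q - 1) →
      (0 ≤ d x ∧ d x ≤ m) ∧ 0 < q * x - d x ∧ q * x - d x ≤ m / (q - 1) ∧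
        (d x < m → q * x - d x ≤ 1) := by
    intro x hx0 hx1
    have hqx : 0 < q * x := by positivity
    have hc : 0 < ⌈q * x⌉ := Int.ceil_pos.2 hqx
    have c1 := Int.le_ceil (q * x)
    have c2 := Int.ceil_lt_add_one (q * x)
    have hqx2 : q * x ≤ q * (m / (q - 1)) := by gcongr
    rcases le_total (m : ℤ) (⌈q * x⌉ - 1) with hle | hle
    · have hd : d x = m := min_eq_left hle
      have hle' : (m : ℝ) ≤ ⌈q * x⌉ - 1 := by exact_mod_cast hle
      rw [hd]; push_cast
      exact ⟨⟨by positivity, le_rfl⟩, by linarith, by linarith, fun h => absurd h (lt_irrefl _)⟩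
    · have hd : d x = ⌈q * x⌉ - 1 := min_eq_right hle
      rw [hd]; push_cast
      exact ⟨⟨by omega, hle⟩, by linarith, by linarith, fun _ => by linarith⟩
  have hb : ∀ n, 0 < T n ∧ T n ≤ m / (q - 1) := by
    intro n
    induction n with
    | zero => exact ⟨h0, h1⟩
    | succ n ih =>
      have := step _ ih.1 ih.2
      rw [hT]; exact ⟨this.2.1, this.2.2.1⟩
  have hs : IsDigits m fun n => d (T n) := fun n => (step _ (hb n).1 (hb n).2).1
  have hv := digitValue_eq_of_orbit hq hs (fun n => (hb n).1.le) (fun n => (hb n).2) hT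
  refine ⟨_, hs, ?_, fun n => ?_, fun n hn => ?_⟩
  · rw [← shiftSeq_zero (fun n => d (T n)), ← hv]; rfl
  · rw [← hv]; exact (hb n).1
  · rw [← hv, hT]; exact (step _ (hb n).1 (hb n).2).2.2.2 hn

lemma exists_digits_of_mem (hq : 1 < q) (hqm : q ≤ m + 1) {y : ℝ} (h0 : 0 ≤ y)
    (h1 : y ≤ m / (q - 1)) : ∃ s, IsDigits m s ∧ digitValue q s = y := by
  rcases h0.eq_or_lt with rfl | h0
  · refine ⟨fun _ => 0, .const le_rfl (by positivity), ?_⟩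
    rw [digitValue_const (m := m) hq le_rfl (by positivity)]; simp
  · obtain ⟨s, hs, hv, -⟩ := exists_quasiGreedy hq hqm h0 h1
    exact ⟨s, hs, hv⟩

lemma exists_digits_of_prefix (hq : 1 < q) (hqm : q ≤ m + 1) (hs : IsDigits m s) (k : ℕ) {y : ℝ}
    (h0 : 0 ≤ digitValue q (shiftSeq k s) + q ^ k * (y - digitValue q s))
    (h1 : digitValue q (shiftSeq k s) + q ^ k * (y - digitValue q s) ≤ m / (q - 1)) :
    ∃ t, IsDigits m t ∧ (∀ i < k, t i = s i) ∧ digitValue q t = y := by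
  obtain ⟨r, hr, hrv⟩ := exists_digits_of_mem hq hqm h0 h1
  refine ⟨appendSeq k s r, hs.append hr k, fun i hi => appendSeq_of_lt s r hi, ?_⟩
  have h := digitValue_appendSeq hq hs hr k
  rw [hrv] at h
  have hq0 : q ^ k ≠ 0 := pow_ne_zero _ (by linarith)
  have : q ^ k * (digitValue q (appendSeq k s r) - y) = 0 := by linarith
  have := (mul_eq_zero.1 this).resolve_left hq0
  linarith

/-- Changing digit `n` is compensated in the tail, which can be re-expanded as long as the new tail
value lies in [0, M]. -/
lemma exists_digits_of_digit (hq : 1 < q) (hqm : q ≤ m + 1) (hs : IsDigits m s) (n : ℕ) {d : ℤ}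
    (hd0 : 0 ≤ d) (hd1 : d ≤ m) (h0 : 0 ≤ digitValue q (shiftSeq (n + 1) s) + s n - d)
    (h1 : digitValue q (shiftSeq (n + 1) s) + s n - d ≤ m / (q - 1)) :
    ∃ t, IsDigits m t ∧ (∀ i < n, t i = s i) ∧ t n = d ∧ digitValue q t = digitValue q s := by
  have hu : IsDigits m (Function.update s n d) := fun i => by
    by_cases h : i = n
    · subst h; simpa using ⟨hd0, hd1⟩
    · simpa [h] using hs i
  have hpre : ∀ i < n, Function.update s n d i = s i := fun i hi => by simp [hi.ne]
  have hsh : shiftSeq (n + 1) (Function.update s n d) = shiftSeq (n + 1) s := by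
    funext i; simp [shiftSeq, show n + 1 + i ≠ n by omega]
  have e := pow_succ_mul_digitValue_sub hq hu hs hpre
  rw [hsh, Function.update_self] at e
  obtain ⟨t, ht, htp, htv⟩ := exists_digits_of_prefix hq hqm hu (n + 1) (y := digitValue q s)
    (by rw [hsh]; linarith) (by rw [hsh]; linarith)
  refine ⟨t, ht, fun i hi => by rw [htp i (by omega), hpre i hi], ?_, htv⟩
  rw [htp n (by omega), Function.update_self]

namespace IsUniqueDigits

lemma shift (hq : 1 < q) (h : IsUniqueDigits m q s) (k : ℕ) :
    IsUniqueDigits m q (shiftSeq k s) := by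
  refine ⟨h.1.shift k, fun t ht htv => ?_⟩
  have e := digitValue_appendSeq hq h.1 ht k
  rw [htv, sub_self] at e
  have := (mul_eq_zero.1 e).resolve_left (pow_ne_zero _ (by linarith))
  rw [← h.2 _ (h.1.append ht k) (by linarith), shiftSeq_appendSeq]

lemma tail_lt_one (hq : 1 < q) (hqm : q ≤ m + 1) (h : IsUniqueDigits m q s) {n : ℕ}
    (hn : s n < m) : digitValue q (shiftSeq (n + 1) s) < 1 := by
  by_contra hge
  have c := digitValue_le hq (h.1.shift (n + 1))
  obtain ⟨t, ht, -, htn, htv⟩ := exists_digits_of_digit hq hqm h.1 n (d := s n + 1)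
    (by have := (h.1 n).1; omega) (by omega) (by push_cast; linarith) (by push_cast; linarith)
  rw [h.2 t ht htv] at htn
  omega

lemma mirror (hq : 1 < q) (h : IsUniqueDigits m q s) : IsUniqueDigits m q (mirror m s) := by
  refine ⟨h.1.mirror, fun t ht htv => ?_⟩
  rw [digitValue_mirror hq h.1] at htv
  rw [← h.2 _ ht.mirror (by rw [digitValue_mirror hq ht]; linarith), mirror_mirror]

/-- The bound persists through digits `m`: from x < 1 and q ≤ m+1 follows qx - m < 1. -/
lemma tail_lt_one_of_le (hq : 1 < q) (hqm : q ≤ m + 1) (h : IsUniqueDigits m q s) {n : ℕ}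
    (hn : s n < m) {j : ℕ} (hj : n + 1 ≤ j) : digitValue q (shiftSeq j s) < 1 := by
  induction j, hj using Nat.le_induction with
  | base => exact h.tail_lt_one hq hqm hn
  | succ j hj ih =>
    rcases (h.1 j).2.lt_or_eq with hlt | heq
    · exact h.tail_lt_one hq hqm hlt
    · have := mul_digitValue_shift hq h.1 j
      rw [heq] at this
      push_cast at this
      nlinarith

lemma lt_tail_of_le (hq : 1 < q) (hqm : q ≤ m + 1) (h : IsUniqueDigits m q s) {n : ℕ}
    (hn : 0 < s n) {j : ℕ} (hj : n + 1 ≤ j) :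
    m / (q - 1) - 1 < digitValue q (shiftSeq j s) := by
  have := (h.mirror hq).tail_lt_one_of_le hq hqm (n := n) (by simp only [_root_.mirror]; omega) hj
  rw [shiftSeq_mirror, digitValue_mirror hq (h.1.shift j)] at this
  linarith

/-- If `q` is at most the generalized golden ratio, then only the constant sequences `0` and `m`
are unique expansions. -/
lemma eq_const (hq : 1 < q) (hqm : q ≤ m + 1) (h : IsUniqueDigits m q s)
    (hG : 2 * (q - 1) ≤ m ∨ Odd m ∧ 2 * q ^ 2 ≤ (m + 1) * (q + 1)) :
    s = (fun _ => 0) ∨ s = fun _ => (m : ℤ) := by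
  by_contra! hne
  obtain ⟨⟨a, ha⟩, b, hb⟩ := hne.imp Function.ne_iff.1 Function.ne_iff.1
  have hq1 : 0 < q - 1 := by linarith
  -- Past a nonzero digit and a digit other than `m`, all tails lie in (M-1, 1). This interval is
  -- empty when M ≥ 2.
  have hlo : ∀ j, a + b + 1 ≤ j → m / (q - 1) - 1 < digitValue q (shiftSeq j s) := fun j hj =>
    h.lt_tail_of_le hq hqm (lt_of_le_of_ne (h.1 a).1 (Ne.symm ha)) (by omega)
  have hhi : ∀ j, a + b + 1 ≤ j → digitValue q (shiftSeq j s) < 1 := fun j hj =>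
    h.tail_lt_one_of_le hq hqm (lt_of_le_of_ne (h.1 b).2 hb) (by omega)
  have l1 := hlo _ le_rfl
  have u1 := hhi _ le_rfl
  have l2 := hlo _ (Nat.le_succ _)
  have u2 := hhi _ (Nat.le_succ _)
  have e := mul_digitValue_shift hq h.1 (a + b + 1)
  rw [← Nat.succ_eq_add_one (a + b + 1)] at e
  set M := (m : ℝ) / (q - 1) with hM
  set x := digitValue q (shiftSeq (a + b + 1) s)
  set y := digitValue q (shiftSeq (Nat.succ (a + b + 1)) s)
  have hMq : M * (q - 1) = m := by rw [hM]; field_simp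
  rcases hG with hG | ⟨⟨k, hk⟩, hG⟩
  · have : 2 ≤ M := by rw [hM, le_div_iff₀ hq1]; exact hG
    linarith
  · have hk' : (m : ℝ) = 2 * k + 1 := by exact_mod_cast hk
    -- With δ = 1 - M/2 the half-length of (M-1, 1), the next tail satisfies y - M/2 = q(x - M/2) +
    -- (m/2 - d). For odd `m` the last term has size at least 1/2, which pushes `y` out of the
    -- interval once (q+1)δ ≤ 1/2.
    have hδ : (q + 1) * (1 - M / 2) ≤ 1 / 2 := by
      by_contra hgt
      have : 0 < ((q + 1) * (1 - M / 2) - 1 / 2) * (q - 1) := mul_pos (by linarith) hq1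
      have e2 : ((q + 1) * (1 - M / 2) - 1 / 2) * (q - 1)
        = (q + 1) * (q - 1) - (q + 1) * m / 2 - (q - 1) / 2 := by rw [← hMq]; ring
      nlinarith
    have hx1 := mul_lt_mul_of_pos_left u1 (by linarith : 0 < q)
    have hx2 := mul_lt_mul_of_pos_left l1 (by linarith : 0 < q)
    rcases le_or_gt (s (a + b + 1)) k with hd | hd
    · have hd' : (s (a + b + 1) : ℝ) ≤ k := by exact_mod_cast hd
      nlinarith
    · have hd' : (k : ℝ) + 1 ≤ s (a + b + 1) := by exact_mod_cast hd
      nlinarith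

end IsUniqueDigits

lemma isUniqueDigits_zero (hq : 1 < q) : IsUniqueDigits m q (fun _ => 0) := by
  refine ⟨.const le_rfl (by positivity), fun t ht htv => ?_⟩
  rw [digitValue_const (m := m) hq le_rfl (by positivity), Int.cast_zero, zero_div] at htv
  funext i
  by_contra hne
  exact (digitValue_pos hq ht hne).ne' htv

lemma isUniqueDigits_max (hq : 1 < q) : IsUniqueDigits m q (fun _ => (m : ℤ)) := by
  have e : mirror m (fun _ => 0) = fun _ => (m : ℤ) := funext fun _ => by simp [mirror]
  exact e ▸ (isUniqueDigits_zero (m := m) hq).mirror hq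

/-- `s` has no last digit different from `0`, and none different from `m`. -/
def IsDoublyInfiniteDigits (m : ℕ) (s : ℕ → ℤ) : Prop :=
  (∀ n, s n ≠ 0 → ∃ k, n < k ∧ s k ≠ 0) ∧ ∀ n, s n ≠ m → ∃ k, n < k ∧ s k ≠ m

lemma IsDoublyInfiniteDigits.mirror (h : IsDoublyInfiniteDigits m s) :
    IsDoublyInfiniteDigits m (mirror m s) := by
  refine ⟨fun n hn => ?_, fun n hn => ?_⟩
  · obtain ⟨k, hk, hk'⟩ := h.2 n (by simp only [_root_.mirror] at hn; omega)
    exact ⟨k, hk, by simp only [_root_.mirror]; omega⟩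
  · obtain ⟨k, hk, hk'⟩ := h.1 n (by simp only [_root_.mirror] at hn; omega)
    exact ⟨k, hk, by simp only [_root_.mirror]; omega⟩

/-- If two doubly infinite expansions of `x` differ, then no number near `x` has a unique
expansion. -/
lemma not_mem_closure_of_two_doublyInfinite (hq : 1 < q) (hqm : q ≤ m + 1) (hs : IsDigits m s)
    (ht : IsDigits m t) (hst : digitValue q s = digitValue q t) (hs' : IsDoublyInfiniteDigits m s)
    (ht' : IsDoublyInfiniteDigits m t) {k : ℕ} (hk : ∀ i < k, s i = t i) (hlt : s k < t k) :
    digitValue q s ∉ closure {x | ∃ r, IsUniqueDigits m q r ∧ digitValue q r = x} := by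
  intro hcl
  have e := pow_succ_mul_digitValue_sub hq hs ht hk
  rw [hst, sub_self, mul_zero] at e
  have hlt' : (s k : ℝ) + 1 ≤ t k := by exact_mod_cast hlt
  have hsk := hs k
  have htk := ht k
  obtain ⟨i, hi, hi'⟩ := ht'.1 k (by omega)
  obtain ⟨j, hj, hj'⟩ := hs'.2 k (by omega)
  have hpos := digitValue_pos hq (ht.shift (k + 1)) (n := i - (k + 1))
    (by simpa [shiftSeq, show k + 1 + (i - (k + 1)) = i by omega] using hi')
  have hltM := digitValue_lt hq (hs.shift (k + 1)) (n := j - (k + 1))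
    (by simpa [shiftSeq, show k + 1 + (j - (k + 1)) = j by omega] using hj')
  have hqk : 0 < q ^ (k + 1) := pow_pos (by linarith) _
  set A := digitValue q (shiftSeq (k + 1) s)
  set B := digitValue q (shiftSeq (k + 1) t)
  -- Double infiniteness gives B > 0 and A < M, and also A ≥ B + 1. Within this radius both tails
  -- can be adjusted inside [0, M], so the nearby point inherits two expansions.
  obtain ⟨x, ⟨r, hr, rfl⟩, hx⟩ := Metric.mem_closure_iff.1 hcl (min B (m / (q - 1) - A) / q ^ (k + 1))
    (div_pos (lt_min hpos (by linarith)) hqk)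
  rw [Real.dist_eq, lt_div_iff₀ hqk, ← abs_of_pos hqk, ← abs_mul, lt_min_iff, abs_lt,
    abs_lt] at hx
  obtain ⟨⟨x1, x2⟩, x3, x4⟩ := hx
  have e2 : q ^ (k + 1) * (digitValue q r - digitValue q s)
      = -((digitValue q s - digitValue q r) * q ^ (k + 1)) := by ring
  obtain ⟨s₁, h1, h2, h3⟩ := exists_digits_of_prefix hq hqm hs (k + 1) (y := digitValue q r)
    (by rw [e2]; linarith) (by rw [e2]; linarith)
  obtain ⟨t₁, h4, h5, h6⟩ := exists_digits_of_prefix hq hqm ht (k + 1) (y := digitValue q r)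
    (by rw [← hst, e2]; linarith) (by rw [← hst, e2]; linarith)
  have h7 := h2 k (by omega)
  have h8 := h5 k (by omega)
  rw [hr.2 s₁ h1 h3] at h7
  rw [hr.2 t₁ h4 h6] at h8
  omega

end Expansions

/-! ### Passage between `Fin (m + 1)` sequences and integer sequences -/

section Translation
variable {m : ℕ} {q : ℝ}

/-- A sequence over `Fin (m + 1)` as a sequence of integers. -/
def toIntSeq (c : ℕ → Fin (m + 1)) : ℕ → ℤ := fun i => ((c i : ℕ) : ℤ)

lemma toIntSeq_injective : Function.Injective (toIntSeq (m := m)) := fun c d h => by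
  funext i
  have := congrFun h i
  simp only [toIntSeq] at this
  exact Fin.ext (by omega)

lemma isDigits_toIntSeq (c : ℕ → Fin (m + 1)) : IsDigits m (toIntSeq c) := fun i => by
  have := (c i).2
  simp only [toIntSeq]; omega

lemma IsDigits.exists_toIntSeq {s : ℕ → ℤ} (hs : IsDigits m s) : ∃ c, toIntSeq (m := m) c = s := by
  refine ⟨fun i => ⟨(s i).toNat, by have := hs i; omega⟩, funext fun i => ?_⟩
  have := hs i
  simp only [toIntSeq]; omega

lemma isExpansion_iff (hq : 1 < q) {c : ℕ → Fin (m + 1)} {x : ℝ} :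
    IsExpansion m q c x ↔ digitValue q (toIntSeq c) = x := by
  have h := (isDigits_toIntSeq c).hasSum hq
  simp only [toIntSeq, Int.cast_natCast] at h
  exact ⟨fun hx => h.unique hx, fun hx => by rw [← hx]; exact h⟩

lemma isDoublyInfinite_iff {c : ℕ → Fin (m + 1)} :
    IsDoublyInfinite c ↔ IsDoublyInfiniteDigits m (toIntSeq c) := by
  have h0 : ∀ i, c i ≠ 0 ↔ toIntSeq c i ≠ 0 := fun i => by
    rw [Ne, Fin.ext_iff, toIntSeq]; simp
  have h1 : ∀ i, reflection c i ≠ 0 ↔ toIntSeq c i ≠ m := fun i => by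
    have := (c i).2
    rw [Ne, Fin.ext_iff, toIntSeq, reflection, Fin.val_rev, Fin.val_zero]; omega
  unfold IsDoublyInfinite IsInfinite IsDoublyInfiniteDigits
  push Not
  simp only [h0, h1]

lemma mem_baseInterval_of_digits (hq : 1 < q) {s : ℕ → ℤ} (hs : IsDigits m s) :
    digitValue q s ∈ baseInterval m q :=
  ⟨digitValue_nonneg hq hs, digitValue_le hq hs⟩

lemma univoqueSet_eq (hq : 1 < q) :
    univoqueSet m q = {x | ∃ s, IsUniqueDigits m q s ∧ digitValue q s = x} := by
  ext x
  constructor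
  · rintro ⟨-, c, hc, hu⟩
    rw [isExpansion_iff hq] at hc
    refine ⟨toIntSeq c, ⟨isDigits_toIntSeq c, fun t ht htv => ?_⟩, hc⟩
    obtain ⟨d, rfl⟩ := ht.exists_toIntSeq
    rw [hu d ((isExpansion_iff hq).2 (htv.trans hc))]
  · rintro ⟨s, ⟨hs, hu⟩, rfl⟩
    obtain ⟨c, rfl⟩ := hs.exists_toIntSeq
    refine ⟨mem_baseInterval_of_digits hq hs, c, (isExpansion_iff hq).2 rfl, fun d hd => ?_⟩
    exact toIntSeq_injective (hu _ (isDigits_toIntSeq d) ((isExpansion_iff hq).1 hd))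

lemma mem_doublySet_iff (hq : 1 < q) {x : ℝ} :
    x ∈ doublySet m q ↔ x ∈ baseInterval m q ∧ ∀ s t, IsDigits m s → IsDigits m t →
      digitValue q s = x → digitValue q t = x → IsDoublyInfiniteDigits m s →
      IsDoublyInfiniteDigits m t → s = t := by
  refine and_congr_right fun _ => ⟨fun h s t hs ht hsv htv hsd htd => ?_, fun h c hc d hd => ?_⟩
  · obtain ⟨c, rfl⟩ := hs.exists_toIntSeq
    obtain ⟨d, rfl⟩ := ht.exists_toIntSeq
    rw [h ⟨(isExpansion_iff hq).2 hsv, isDoublyInfinite_iff.2 hsd⟩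
      ⟨(isExpansion_iff hq).2 htv, isDoublyInfinite_iff.2 htd⟩]
  · exact toIntSeq_injective (h _ _ (isDigits_toIntSeq c) (isDigits_toIntSeq d)
      ((isExpansion_iff hq).1 hc.1) ((isExpansion_iff hq).1 hd.1) (isDoublyInfinite_iff.1 hc.2)
      (isDoublyInfinite_iff.1 hd.2))

lemma mem_basesTwo_iff (hq : q ∈ Ioc (1 : ℝ) (m + 1)) :
    q ∈ basesTwo m ↔ ∃ s t, IsDigits m s ∧ IsDigits m t ∧ s ≠ t ∧
      digitValue q s = digitValue q t ∧
      ∀ r, IsDigits m r → digitValue q r = digitValue q s → r = s ∨ r = t := by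
  constructor
  · rintro ⟨-, x, -, h2⟩
    obtain ⟨c, d, hne, he⟩ := Set.encard_eq_two.1 h2
    have hmem : ∀ e, digitValue q (toIntSeq e) = x ↔ e = c ∨ e = d := fun e => by
      rw [← isExpansion_iff hq.1]; exact Set.ext_iff.1 he e
    have hc := (hmem c).2 (Or.inl rfl)
    have hd := (hmem d).2 (Or.inr rfl)
    refine ⟨toIntSeq c, toIntSeq d, isDigits_toIntSeq c, isDigits_toIntSeq d,
      toIntSeq_injective.ne hne, hc.trans hd.symm, fun r hr hrv => ?_⟩
    obtain ⟨e, rfl⟩ := hr.exists_toIntSeq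
    exact ((hmem e).1 (hrv.trans hc)).imp (congrArg _) (congrArg _)
  · rintro ⟨s, t, hs, ht, hne, hst, hr⟩
    obtain ⟨c, rfl⟩ := hs.exists_toIntSeq
    obtain ⟨d, rfl⟩ := ht.exists_toIntSeq
    refine ⟨hq, _, mem_baseInterval_of_digits hq.1 hs,
      Set.encard_eq_two.2 ⟨c, d, fun h => hne (by rw [h]), ?_⟩⟩
    ext e
    simp only [mem_ofPred_eq, mem_insert_iff, mem_singleton_iff, isExpansion_iff hq.1]
    constructor
    · intro he
      exact (hr _ (isDigits_toIntSeq e) he).imp (@toIntSeq_injective m _ _)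
        (@toIntSeq_injective m _ _)
    · rintro (rfl | rfl)
      exacts [rfl, hst.symm]

end Translation

/-! ### The equivalence (i) ⇔ (ii), and (iii) ⇒ (iv) -/

section Implications
variable {m : ℕ} {q : ℝ}

lemma one_mem_univoque_sub_iff (hq : 1 < q) : (1 : ℝ) ∈ univoqueSet m q - univoqueSet m q ↔
    ∃ s t, IsUniqueDigits m q s ∧ IsUniqueDigits m q t ∧ digitValue q s = digitValue q t + 1 := by
  rw [univoqueSet_eq hq, Set.mem_sub]
  constructor
  · rintro ⟨_, ⟨s, hs, rfl⟩, _, ⟨t, ht, rfl⟩, h⟩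
    exact ⟨s, t, hs, ht, by linarith⟩
  · rintro ⟨s, t, hs, ht, h⟩
    exact ⟨_, ⟨s, hs, rfl⟩, _, ⟨t, ht, rfl⟩, by linarith⟩

lemma one_mem_sub_of_lt {s t : ℕ → ℤ} (hq : 1 < q) (hqm : q ≤ m + 1) (hs : IsDigits m s)
    (ht : IsDigits m t) (hst : digitValue q s = digitValue q t)
    (hr : ∀ r, IsDigits m r → digitValue q r = digitValue q s → r = s ∨ r = t) {k : ℕ}
    (hk : ∀ i < k, s i = t i) (hlt : s k < t k) :
    ∃ s t, IsUniqueDigits m q s ∧ IsUniqueDigits m q t ∧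
      digitValue q s = digitValue q t + 1 := by
  have e := pow_succ_mul_digitValue_sub hq hs ht hk
  rw [hst, sub_self, mul_zero] at e
  have h0 := digitValue_nonneg hq (ht.shift (k + 1))
  have h1 := digitValue_le hq (hs.shift (k + 1))
  have hsk := hs k
  have htk := ht k
  -- A gap of two or more would leave room for a third expansion with an intermediate digit.
  have hd : t k = s k + 1 := by
    by_contra hne
    have h2 : (s k : ℝ) + 2 ≤ t k := by exact_mod_cast (show s k + 2 ≤ t k by omega)
    obtain ⟨r, hrd, -, hrk, hrv⟩ := exists_digits_of_digit hq hqm hs k (d := s k + 1) (by omega)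
      (by omega) (by push_cast; linarith) (by push_cast; linarith)
    rcases hr r hrd hrv with rfl | rfl <;> omega
  have hq0 : q ^ (k + 1) ≠ 0 := pow_ne_zero _ (by linarith)
  refine ⟨shiftSeq (k + 1) s, shiftSeq (k + 1) t, ⟨hs.shift _, fun r hrd hrv => ?_⟩,
    ⟨ht.shift _, fun r hrd hrv => ?_⟩, by rw [hd] at e; push_cast at e; linarith⟩
  · have e2 := digitValue_appendSeq hq hs hrd (k + 1)
    rw [hrv, sub_self] at e2
    have e3 := (mul_eq_zero.1 e2).resolve_left hq0
    rcases hr _ (hs.append hrd (k + 1)) (by linarith) with h | h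
    · conv_rhs => rw [← h]
      rw [shiftSeq_appendSeq]
    · have := congrFun h k
      rw [appendSeq_of_lt s r (by omega)] at this
      omega
  · have e2 := digitValue_appendSeq hq ht hrd (k + 1)
    rw [hrv, sub_self] at e2
    have e3 := (mul_eq_zero.1 e2).resolve_left hq0
    rcases hr _ (ht.append hrd (k + 1)) (by linarith) with h | h
    · have := congrFun h k
      rw [appendSeq_of_lt t r (by omega)] at this
      omega
    · conv_rhs => rw [← h]
      rw [shiftSeq_appendSeq]

lemma one_mem_univoque_sub_of_mem_basesTwo (hq : q ∈ Ioc (1 : ℝ) (m + 1)) (h : q ∈ basesTwo m) :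
    (1 : ℝ) ∈ univoqueSet m q - univoqueSet m q := by
  rw [one_mem_univoque_sub_iff hq.1]
  obtain ⟨s, t, hs, ht, hne, hst, hr⟩ := (mem_basesTwo_iff hq).1 h
  obtain ⟨k, hk, hkne⟩ := exists_first_ne hne
  rcases lt_or_gt_of_ne hkne with hlt | hlt
  · exact one_mem_sub_of_lt hq.1 hq.2 hs ht hst hr hk hlt
  · exact one_mem_sub_of_lt hq.1 hq.2 ht hs hst.symm
      (fun r hrd hrv => (hr r hrd (hrv.trans hst.symm)).symm) (fun i hi => (hk i hi).symm) hlt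

lemma digitValue_eq_of_eq_const (hq : 1 < q) {s : ℕ → ℤ}
    (h : s = (fun _ => 0) ∨ s = fun _ => (m : ℤ)) :
    digitValue q s = 0 ∨ digitValue q s = m / (q - 1) := by
  refine h.imp (fun h => ?_) fun h => ?_
  · rw [h, digitValue_const (m := m) hq le_rfl (by positivity)]; simp
  · rw [h, digitValue_const (m := m) hq (by positivity) le_rfl]; simp

lemma mem_basesTwo_of_one_mem_univoque_sub (hm : 1 ≤ m) (hq : q ∈ Ioc (1 : ℝ) (m + 1))
    (h : (1 : ℝ) ∈ univoqueSet m q - univoqueSet m q) : q ∈ basesTwo m := by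
  obtain ⟨hq1, hqm⟩ := hq
  obtain ⟨s, t, hs, ht, hst⟩ := (one_mem_univoque_sub_iff hq1).1 h
  have hm' : (1 : ℝ) ≤ m := by exact_mod_cast hm
  -- If M ≥ 2, only 0 and M have unique expansions, and they do not differ by 1. The bound M < 2
  -- later rules out a third expansion with first digit at least 2.
  have hM : (m : ℝ) / (q - 1) < 2 := by
    by_contra! hge
    rw [le_div_iff₀ (by linarith)] at hge
    have h0 : 2 ≤ (m : ℝ) / (q - 1) := by rwa [le_div_iff₀ (by linarith)]
    rcases digitValue_eq_of_eq_const hq1 (hs.eq_const hq1 hqm (Or.inl hge)) with h1 | h1 <;>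
    rcases digitValue_eq_of_eq_const hq1 (ht.eq_const hq1 hqm (Or.inl hge)) with h2 | h2 <;>
    linarith
  have hz : IsDigits m fun _ => 0 := .const le_rfl (by positivity)
  have ho : IsDigits m fun _ => 1 := .const zero_le_one (by exact_mod_cast hm)
  have hs' := hz.append hs.1 1
  have ht' := ho.append ht.1 1
  have es := mul_digitValue hq1 hs'
  have et := mul_digitValue hq1 ht'
  rw [shiftSeq_appendSeq, appendSeq_of_lt _ _ one_pos] at es et
  push_cast at es et
  have hq0 : 0 < q := by linarith
  rw [mem_basesTwo_iff ⟨hq1, hqm⟩]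
  refine ⟨_, _, hs', ht', fun h => ?_, ?_, fun r hr hrv => ?_⟩
  · have := congrFun h 0
    rw [appendSeq_of_lt _ _ one_pos, appendSeq_of_lt _ _ one_pos] at this
    omega
  · exact mul_left_cancel₀ hq0.ne' (by linarith)
  · have er := mul_digitValue hq1 hr
    rw [hrv, es] at er
    have hr0 := hr 0
    have key : ∀ d u, IsUniqueDigits m q u → r 0 = d → digitValue q (shiftSeq 1 r) = digitValue q u →
        r = appendSeq 1 (fun _ => d) u := by
      intro d u hu h0 hv
      rw [← hu.2 _ (hr.shift 1) hv]
      conv_lhs => rw [← appendSeq_shiftSeq 1 r]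
      funext i
      unfold appendSeq
      split_ifs with hi
      · rw [← h0, show i = 0 by omega]
      · rfl
    rcases (show r 0 = 0 ∨ r 0 = 1 ∨ 2 ≤ r 0 by omega) with h0 | h0 | h0
    · exact Or.inl (key 0 s hs h0 (by rw [h0] at er; push_cast at er; linarith))
    · exact Or.inr (key 1 t ht h0 (by rw [h0] at er; push_cast at er; linarith))
    · have : (2 : ℝ) ≤ r 0 := by exact_mod_cast h0
      have := digitValue_nonneg hq1 (hr.shift 1)
      have := digitValue_le hq1 hs.1
      linarith

lemma closure_univoqueSet_subset (hq : q ∈ Ioc (1 : ℝ) (m + 1)) :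
    closure (univoqueSet m q) ⊆ doublySet m q := by
  obtain ⟨hq1, hqm⟩ := hq
  intro x hx
  rw [mem_doublySet_iff hq1]
  refine ⟨closure_minimal (fun y hy => hy.1) isClosed_Icc hx, fun s t hs ht hsv htv hsd htd => ?_⟩
  rw [univoqueSet_eq hq1] at hx
  by_contra hne
  obtain ⟨k, hk, hkne⟩ := exists_first_ne hne
  rcases lt_or_gt_of_ne hkne with hlt | hlt
  · exact not_mem_closure_of_two_doublyInfinite hq1 hqm hs ht (hsv.trans htv.symm) hsd htd hk hlt
      (by rwa [hsv])
  · exact not_mem_closure_of_two_doublyInfinite hq1 hqm ht hs (htv.trans hsv.symm) htd hsd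
      (fun i hi => (hk i hi).symm) hlt (by rwa [htv])

lemma goldenRatioGen_of_even (h : Even m) : 2 * (goldenRatioGen m - 1) = m := by
  obtain ⟨k, rfl⟩ := h
  simp only [goldenRatioGen, Even.add_self, if_true, show (k + k) / 2 = k by omega]
  push_cast; ring

/-- The quadratic equation is the equality case of the odd alternative in `IsUniqueDigits.eq_const`.
-/
lemma goldenRatioGen_of_odd (h : Odd m) :
    0 < goldenRatioGen m ∧ 2 * goldenRatioGen m ^ 2 = (m + 1) * (goldenRatioGen m + 1) := by
  obtain ⟨k, rfl⟩ := h
  have hne : ¬ Even (2 * k + 1) := by simp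
  have hs := Real.sq_sqrt (show (0 : ℝ) ≤ (k : ℝ) ^ 2 + 6 * k + 5 by positivity)
  simp only [goldenRatioGen, hne, if_false, show (2 * k + 1) / 2 = k by omega]
  refine ⟨by positivity, ?_⟩
  push_cast
  nlinarith

lemma goldenRatioGen_lt (hm : 1 ≤ m) : goldenRatioGen m < m + 1 := by
  have hm' : (1 : ℝ) ≤ m := by exact_mod_cast hm
  rcases Nat.even_or_odd m with h | h
  · have := goldenRatioGen_of_even h
    linarith
  · obtain ⟨h0, h1⟩ := goldenRatioGen_of_odd h
    by_contra! hge
    nlinarith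

lemma ne_goldenRatioGen_of_mem (hm : 1 ≤ m) (hq : q ∈ Ioc (1 : ℝ) (m + 1))
    (h : (1 : ℝ) ∈ closure (univoqueSet m q) - closure (univoqueSet m q)) :
    q ≠ goldenRatioGen m := by
  intro hG
  have hlt : q < m + 1 := hG ▸ goldenRatioGen_lt hm
  have hM : 1 < (m : ℝ) / (q - 1) := by rw [lt_div_iff₀ (by linarith [hq.1])]; linarith
  have hsub : closure (univoqueSet m q) ⊆ {0, (m : ℝ) / (q - 1)} := by
    refine closure_minimal ?_ (Set.toFinite _).isClosed
    rw [univoqueSet_eq hq.1]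
    rintro _ ⟨s, hs, rfl⟩
    refine digitValue_eq_of_eq_const hq.1 (hs.eq_const hq.1 hq.2 ?_)
    rw [hG]
    rcases Nat.even_or_odd m with h | h
    · exact Or.inl (goldenRatioGen_of_even h).le
    · exact Or.inr ⟨h, (goldenRatioGen_of_odd h).2.le⟩
  obtain ⟨a, ha, b, hb, hab⟩ := Set.mem_sub.1 h
  rcases hsub ha with rfl | ha <;> rcases hsub hb with rfl | hb
  · linarith
  · rw [mem_singleton_iff.1 hb] at hab; linarith
  · rw [mem_singleton_iff.1 ha] at hab; linarith
  · rw [mem_singleton_iff.1 ha, mem_singleton_iff.1 hb] at hab; linarith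

end Implications

/-! ### Lexicographic comparison across a common prefix -/

section Lex
variable {m : ℕ} {s t : ℕ → ℤ}

lemma eq_or_first_lt_of_toLex_le (h : toLex s ≤ toLex t) :
    s = t ∨ ∃ k, (∀ i < k, s i = t i) ∧ s k < t k :=
  h.eq_or_lt.imp (fun h => toLex.injective h) toLex_lt_iff.1

lemma apply_zero_le_of_toLex_le (h : toLex s ≤ toLex t) : s 0 ≤ t 0 := by
  rcases eq_or_first_lt_of_toLex_le h with rfl | ⟨k, hk, hlt⟩
  · rfl
  · rcases Nat.eq_zero_or_pos k with rfl | h0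
    exacts [hlt.le, (hk 0 h0).le]

lemma toLex_lt_of_shift_lt {r : ℕ} (h : ∀ i < r, s i = t i)
    (hlt : toLex (shiftSeq r s) < toLex (shiftSeq r t)) : toLex s < toLex t := by
  obtain ⟨k, hk, hlt⟩ := toLex_lt_iff.1 hlt
  refine toLex_lt_iff.2 ⟨r + k, fun i hi => ?_, hlt⟩
  rcases lt_or_ge i r with hir | hir
  · exact h i hir
  · have := hk (i - r) (by omega)
    simpa [shiftSeq, Nat.add_sub_cancel' hir] using this

lemma shift_toLex_le {r : ℕ} (h : ∀ i < r, s i = t i) (hle : toLex s ≤ toLex t) :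
    toLex (shiftSeq r s) ≤ toLex (shiftSeq r t) := by
  by_contra hlt
  exact absurd hle (not_le.2 (toLex_lt_of_shift_lt (fun i hi => (h i hi).symm) (not_le.1 hlt)))

lemma eq_of_shift_eq {r : ℕ} (h : ∀ i < r, s i = t i) (hs : shiftSeq r s = shiftSeq r t) :
    s = t := by
  funext i
  rcases lt_or_ge i r with hir | hir
  · exact h i hir
  · simpa [shiftSeq, Nat.add_sub_cancel' hir] using congrFun hs (i - r)

end Lex

/-! ### The bumped mirror sequence -/

/-- The periodic sequence whose period is the mirror image of `a_0 … a_{j-1}`, with the last digit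
increased by one. -/
def bumpedMirror (m j : ℕ) (a : ℕ → ℤ) : ℕ → ℤ :=
  fun i => m - a (i % j) + if i % j = j - 1 then 1 else 0

section Bumped
variable {m j : ℕ} {a : ℕ → ℤ}

lemma bumpedMirror_of_lt {i : ℕ} (h : i < j - 1) : bumpedMirror m j a i = m - a i := by
  rw [bumpedMirror, Nat.mod_eq_of_lt (by omega), if_neg (by omega), add_zero]

lemma bumpedMirror_last (hj : 1 ≤ j) : bumpedMirror m j a (j - 1) = m - a (j - 1) + 1 := by
  rw [bumpedMirror, Nat.mod_eq_of_lt (by omega), if_pos rfl]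

lemma shiftSeq_bumpedMirror (n : ℕ) :
    shiftSeq n (bumpedMirror m j a) = shiftSeq (n % j) (bumpedMirror m j a) := by
  funext i
  simp only [shiftSeq, bumpedMirror, Nat.mod_add_mod]

lemma shiftSeq_bumpedMirror_self : shiftSeq j (bumpedMirror m j a) = bumpedMirror m j a := by
  rw [shiftSeq_bumpedMirror, Nat.mod_self, shiftSeq_zero]

lemma isDigits_bumpedMirror (ha : IsDigits m a) (hpos : 0 < a (j - 1)) :
    IsDigits m (bumpedMirror m j a) := fun i => by
  have := ha (i % j)
  unfold bumpedMirror
  split_ifs with h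
  · rw [← h] at hpos; omega
  · omega

/-- By `hstar`, each final piece of the mirrored block is already below `a` inside the block.
Raising the last digit can at worst produce a tie, and then `hU` decides at the next period.
Mirroring gives back a tail of `a` up to the last digit of the block, which is one smaller. -/
lemma bumpedMirror_tails (hj : 1 ≤ j) (hle : ∀ n, toLex (shiftSeq n a) ≤ toLex a)
    (hstar : ∀ i < j, ∃ k < j - i, (∀ t < k, (m : ℤ) - a (i + t) = a t) ∧ m - a (i + k) < a k)
    (hU : ∀ i < j, (∀ t < j - i, bumpedMirror m j a (i + t) = a t) →
      toLex (bumpedMirror m j a) < toLex (shiftSeq (j - i) a)) (n : ℕ) :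
    toLex (shiftSeq n (bumpedMirror m j a)) < toLex a ∧
      toLex (mirror m (shiftSeq n (bumpedMirror m j a))) < toLex a := by
  rw [shiftSeq_bumpedMirror]
  have hi : n % j < j := Nat.mod_lt _ hj
  generalize n % j = i at hi
  have hlast := bumpedMirror_last (m := m) (a := a) hj
  constructor
  · obtain ⟨k, hk, hpre, hlt⟩ := hstar i hi
    have hpre' : ∀ t < k, shiftSeq i (bumpedMirror m j a) t = a t := fun t ht => by
      rw [shiftSeq, bumpedMirror_of_lt (by omega), hpre t ht]
    rcases lt_or_ge (i + k) (j - 1) with hk1 | hk1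
    · refine toLex_lt_iff.2 ⟨k, hpre', ?_⟩
      rwa [shiftSeq, bumpedMirror_of_lt hk1]
    · have hik : i + k = j - 1 := by omega
      rcases lt_or_ge (bumpedMirror m j a (i + k)) (a k) with h1 | h1
      · exact toLex_lt_iff.2 ⟨k, hpre', h1⟩
      · have hag : ∀ t < j - i, shiftSeq i (bumpedMirror m j a) t = a t := by
          intro t ht
          rcases lt_or_ge t k with htk | htk
          · exact hpre' t htk
          · rw [show t = k by omega, shiftSeq]
            rw [hik] at h1 hlt ⊢
            omega
        refine toLex_lt_of_shift_lt hag ?_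
        rw [shiftSeq_shiftSeq, show i + (j - i) = j by omega, shiftSeq_bumpedMirror_self]
        exact hU i hi hag
  · refine lt_of_lt_of_le (toLex_lt_iff.2 ⟨j - 1 - i, fun t ht => ?_, ?_⟩) (hle i)
    · simp only [mirror, shiftSeq]
      rw [bumpedMirror_of_lt (by omega)]; ring
    · simp only [mirror, shiftSeq]
      rw [show i + (j - 1 - i) = j - 1 by omega, hlast]; omega

end Bumped

/-! ### From an expansion of 1 to two univoque points at distance 1 -/

section Construction
variable {m : ℕ} {q : ℝ} {a : ℕ → ℤ}

/-- The pair is `c` and `0^N w`. As `a` repeats after `N` digits with value 1, raising digit `N - 1`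
cancels the lost tail: q^N (value of c - 1) = 1 + (value of w) - 1. The zero prefix needs only `0 <
a 0`. -/
lemma exists_unique_pair (hq : 1 < q) (ha : IsDigits m a) (ha1 : digitValue q a = 1)
    (hpos : ∀ n, 0 < digitValue q (shiftSeq n a)) (ha0 : 0 < a 0) {N : ℕ} (hN : 1 ≤ N)
    (hper : shiftSeq N a = a) {w c : ℕ → ℤ} (hw : IsDigits m w)
    (hwt : ∀ n, toLex (shiftSeq n w) < toLex a ∧ toLex (mirror m (shiftSeq n w)) < toLex a)
    (hc : IsDigits m c)
    (hct : ∀ n, 1 ≤ n → n < N →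
      toLex (shiftSeq n c) < toLex a ∧ toLex (mirror m (shiftSeq n c)) < toLex a)
    (hpre : ∀ i < N - 1, c i = a i) (hlast : c (N - 1) = a (N - 1) + 1)
    (hcw : shiftSeq N c = w) :
    ∃ s t, IsUniqueDigits m q s ∧ IsUniqueDigits m q t ∧
      digitValue q s = digitValue q t + 1 := by
  have hct' : ∀ n, toLex (shiftSeq (n + 1) c) < toLex a ∧
      toLex (mirror m (shiftSeq (n + 1) c)) < toLex a := by
    intro n
    rcases lt_or_ge (n + 1) N with h | h
    · exact hct _ (by omega) h
    · have := hwt (n + 1 - N)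
      rwa [← hcw, shiftSeq_shiftSeq, Nat.add_sub_cancel' h] at this
  have hz : IsDigits m fun _ => 0 := .const le_rfl (by positivity)
  have hd := hz.append hw N
  have hsh : ∀ n, N ≤ n → shiftSeq n (appendSeq N (fun _ => 0) w) = shiftSeq (n - N) w := by
    intro n hn
    conv_rhs => rw [← shiftSeq_appendSeq N (fun _ => 0) w]
    rw [shiftSeq_shiftSeq, Nat.add_sub_cancel' hn]
  refine ⟨c, appendSeq N (fun _ => 0) w,
    .of_lex hq ha ha1 hpos hc (fun n _ => (hct' n).1) (fun n _ => (hct' n).2),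
    .of_lex hq ha ha1 hpos hd (fun n _ => ?_) (fun n hn => ?_), ?_⟩
  · rcases lt_or_ge (n + 1) N with h | h
    · refine toLex_lt_iff.2 ⟨0, by simp, ?_⟩
      rwa [shiftSeq, appendSeq_of_lt _ _ (by omega)]
    · rw [hsh _ h]; exact (hwt _).1
  · rcases lt_or_ge n N with h | h
    · rw [appendSeq_of_lt _ _ h] at hn
      exact absurd hn (lt_irrefl _)
    · rw [hsh _ (by omega)]; exact (hwt _).2
  · have e1 := pow_succ_mul_digitValue_sub hq hc ha hpre
    rw [Nat.sub_add_cancel hN, hlast, hcw, hper, ha1] at e1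
    have e2 := digitValue_appendSeq hq hz hw N
    have e3 : digitValue q (fun _ => 0) = 0 := by
      rw [digitValue_const (m := m) hq le_rfl (by positivity)]; simp
    have e4 : shiftSeq N (fun _ : ℕ => (0 : ℤ)) = fun _ => 0 := rfl
    rw [e4, e3, sub_zero, sub_zero] at e2
    push_cast at e1
    have : q ^ N * (digitValue q c - 1 - digitValue q (appendSeq N (fun _ => 0) w)) = 0 := by
      rw [mul_sub, e2, e1]; ring
    have := (mul_eq_zero.1 this).resolve_left (pow_ne_zero _ (by linarith))
    linarith

/-- The case where the expansion of `1` is periodic and no tail of it is its mirror image. -/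
lemma exists_unique_pair_of_periodic (hq : 1 < q) (hqm : q < m + 1) (ha : IsDigits m a)
    (ha1 : digitValue q a = 1) (hpos : ∀ n, 0 < digitValue q (shiftSeq n a))
    (hle1 : ∀ n, digitValue q (shiftSeq n a) ≤ 1) (hle : ∀ n, toLex (shiftSeq n a) ≤ toLex a)
    (hmir : ∀ n, 1 ≤ n → toLex (mirror m (shiftSeq n a)) < toLex a) (ha0 : 0 < a 0)
    {N : ℕ} (hN : 1 ≤ N) (hper : shiftSeq N a = a)
    (hmin : ∀ n, 1 ≤ n → n < N → shiftSeq n a ≠ a) :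
    ∃ s t, IsUniqueDigits m q s ∧ IsUniqueDigits m q t ∧
      digitValue q s = digitValue q t + 1 := by
  have hP : Function.Periodic a N := fun x => by
    rw [add_comm]; exact congrFun hper x
  -- Both sequences have period `N`, so a difference must occur within one period.
  have hwin : ∀ k, ∃ d < N, (∀ t < d, (m : ℤ) - a (k + t) = a t) ∧ m - a (k + d) < a d := by
    have h1 : ∀ k, 1 ≤ k →
        ∃ d < N, (∀ t < d, (m : ℤ) - a (k + t) = a t) ∧ m - a (k + d) < a d := by
      intro k hk
      obtain ⟨d, hd, hlt⟩ := toLex_lt_iff.1 (hmir k hk)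
      refine ⟨d, ?_, hd, hlt⟩
      by_contra! hdN
      have hPk : Function.Periodic (fun x => a (k + x)) N := fun x => by
        change a (k + (x + N)) = a (k + x)
        rw [← add_assoc, hP]
      have h2 := hd (d % N) (lt_of_lt_of_le (Nat.mod_lt _ hN) hdN)
      have h3 := hPk.map_mod_nat d
      simp only [mirror, shiftSeq] at h2 h3 hlt
      rw [h3, hP.map_mod_nat] at h2
      omega
    intro k
    rcases Nat.eq_zero_or_pos k with rfl | hk
    · obtain ⟨d, hdN, hd, hlt⟩ := h1 N hN
      have e : ∀ x, a (N + x) = a x := congrFun hper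
      simp only [e] at hd hlt
      exact ⟨d, hdN, by simpa using hd, by simpa using hlt⟩
    · exact h1 k hk
  -- Cut at 3N if every comparison is settled before it. Otherwise cut at the least `j` from which
  -- the mirror image of `a` follows `a` up to 3N. A comparison starting before `j` and settled
  -- after it would make the tail of `a` from `j - i` exceed `a`.
  obtain ⟨j, hNj, hstar⟩ : ∃ j, N < j ∧
      ∀ i < j, ∃ k < j - i, (∀ t < k, (m : ℤ) - a (i + t) = a t) ∧ m - a (i + k) < a k := by
    by_cases h0 : ∀ i < 3 * N, ∃ k < 3 * N - i,
        (∀ t < k, (m : ℤ) - a (i + t) = a t) ∧ m - a (i + k) < a k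
    · exact ⟨3 * N, by omega, h0⟩
    · classical
      have hbad : ∃ i, i < 3 * N ∧ ∀ t < 3 * N - i, (m : ℤ) - a (i + t) = a t := by
        push Not at h0
        obtain ⟨i, hi, hi'⟩ := h0
        obtain ⟨d, -, hd, hlt⟩ := hwin i
        refine ⟨i, hi, fun t ht => hd t ?_⟩
        by_contra! hdt
        exact absurd hlt (not_lt.2 (hi' d (by omega) hd))
      obtain ⟨j, ⟨hj3, hj⟩, hjmin⟩ : ∃ j, (j < 3 * N ∧ ∀ t < 3 * N - j, (m : ℤ) - a (j + t) = a t) ∧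
          ∀ i < j, ¬ (i < 3 * N ∧ ∀ t < 3 * N - i, (m : ℤ) - a (i + t) = a t) :=
        ⟨Nat.find hbad, Nat.find_spec hbad, fun i hi => Nat.find_min hbad hi⟩
      refine ⟨j, ?_, fun i hi => ?_⟩
      · obtain ⟨d, hdN, -, hlt⟩ := hwin j
        by_contra! hle
        have := hj d (by omega)
        omega
      · obtain ⟨d, -, hd, hlt⟩ := hwin i
        refine ⟨d, ?_, hd, hlt⟩
        by_contra! hdj
        have hd3 : d < 3 * N - i := by
          by_contra! h3
          exact hjmin i hi ⟨by omega, fun t ht => hd t (by omega)⟩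
        refine absurd (hle (j - i)) (not_le.2 (toLex_lt_iff.2 ⟨d - (j - i), fun t ht => ?_, ?_⟩))
        · have h1 := hd (j - i + t) (by omega)
          rw [show i + (j - i + t) = j + t by omega] at h1
          rw [shiftSeq, ← h1, hj t (by omega)]
        · have h1 := hj (d - (j - i)) (by omega)
          rw [show j + (d - (j - i)) = i + d by omega] at h1
          rw [shiftSeq, Nat.add_sub_cancel' hdj]
          omega
  -- The difference occurs before position `N ≤ j - 1`, so the raised digit plays no role; this is
  -- why `N < j` is needed.
  have hwlt : ∀ r, toLex (bumpedMirror m j a) < toLex (shiftSeq r a) := by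
    intro r
    obtain ⟨d, hdN, hd, hlt⟩ := hwin r
    refine toLex_lt_iff.2 ⟨d, fun t ht => ?_, ?_⟩
    · have := hd t ht
      rw [bumpedMirror_of_lt (by omega), shiftSeq]; omega
    · rw [bumpedMirror_of_lt (by omega), shiftSeq]; omega
  have hj1 : 1 ≤ j := by omega
  have haj : 0 < a (j - 1) := by
    obtain ⟨k, hk, -, hlt⟩ := hstar (j - 1) (by omega)
    obtain rfl : k = 0 := by omega
    have := ha 0
    rw [add_zero] at hlt; omega
  have hw := isDigits_bumpedMirror ha haj
  have hwt := bumpedMirror_tails hj1 hle hstar fun i hi _ => hwlt _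
  -- There is room to raise this digit: it equals qx - 1 for a tail value x ≤ 1, and q < m + 1.
  have hbump : a (N - 1) + 1 ≤ m := by
    have e := mul_digitValue_shift hq ha (N - 1)
    rw [Nat.sub_add_cancel hN, hper, ha1] at e
    have := hle1 (N - 1)
    have h2 : (a (N - 1) : ℝ) + 1 < m + 1 := by nlinarith
    have h3 : a (N - 1) < m := by
      have : (a (N - 1) : ℝ) < m := by linarith
      exact_mod_cast this
    omega
  set b : ℕ → ℤ := fun i => a i + if i = N - 1 then 1 else 0 with hb
  have hbd : IsDigits m b := fun i => by
    have := ha i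
    simp only [hb]
    split_ifs with h
    · rw [h] at this ⊢; omega
    · omega
  have hb1 : ∀ i, i < N - 1 → appendSeq N b (bumpedMirror m j a) i = a i := fun i hi => by
    rw [appendSeq_of_lt _ _ (by omega), hb]
    simp [show i ≠ N - 1 by omega]
  have hb2 : appendSeq N b (bumpedMirror m j a) (N - 1) = a (N - 1) + 1 := by
    rw [appendSeq_of_lt _ _ (by omega), hb]
    simp
  refine exists_unique_pair hq ha ha1 hpos ha0 hN hper hw hwt (hbd.append hw N)
    (fun i hi1 hiN => ⟨?_, ?_⟩) hb1 hb2 (shiftSeq_appendSeq _ _ _)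
  · have key : ∃ k < N - i, (∀ t < k, a (i + t) = a t) ∧ a (i + k) < a k := by
      by_contra! hno
      have hag : ∀ t < N - i, shiftSeq i a t = a t := by
        rcases eq_or_first_lt_of_toLex_le (hle i) with h | ⟨k, hk, hlt⟩
        · exact fun t _ => congrFun h t
        · refine fun t ht => hk t ?_
          by_contra! hkt
          exact absurd hlt (not_lt.2 (hno k (by omega) hk))
      have h1 := shift_toLex_le hag (hle i)
      rw [shiftSeq_shiftSeq, show i + (N - i) = N by omega, hper] at h1
      exact hmin (N - i) (by omega) (by omega) (toLex.injective (le_antisymm (hle _) h1))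
    obtain ⟨k, hk, hpre, hlt⟩ := key
    have hpre' : ∀ t < k, shiftSeq i (appendSeq N b (bumpedMirror m j a)) t = a t := fun t ht => by
      rw [shiftSeq, hb1 _ (by omega), hpre t ht]
    rcases lt_or_ge (i + k) (N - 1) with hk1 | hk1
    · exact toLex_lt_iff.2 ⟨k, hpre', by rwa [shiftSeq, hb1 _ hk1]⟩
    · have hik : i + k = N - 1 := by omega
      have hck : shiftSeq i (appendSeq N b (bumpedMirror m j a)) k = a (i + k) + 1 := by
        rw [shiftSeq, hik, hb2]
      rcases lt_or_ge (a (i + k) + 1) (a k) with h1 | h1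
      · exact toLex_lt_iff.2 ⟨k, hpre', by rwa [hck]⟩
      · refine toLex_lt_of_shift_lt (r := N - i) (fun t ht => ?_) ?_
        · rcases lt_or_ge t k with htk | htk
          · exact hpre' t htk
          · rw [show t = k by omega, hck]; omega
        · rw [shiftSeq_shiftSeq, show i + (N - i) = N by omega, shiftSeq_appendSeq]
          exact hwlt _
  · refine lt_trans (toLex_lt_iff.2 ⟨N - 1 - i, fun t ht => ?_, ?_⟩) (hmir i hi1)
    · simp only [mirror, shiftSeq]
      rw [hb1 _ (by omega)]
    · simp only [mirror, shiftSeq]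
      rw [show i + (N - 1 - i) = N - 1 by omega, hb2]; omega

/-- The case where some tail of the expansion of `1` is its mirror image. -/
lemma exists_unique_pair_of_antiperiodic (hq : 1 < q) (ha : IsDigits m a)
    (ha1 : digitValue q a = 1) (hpos : ∀ n, 0 < digitValue q (shiftSeq n a))
    (hle : ∀ n, toLex (shiftSeq n a) ≤ toLex a)
    (hmir : ∀ n, 1 ≤ n → toLex (mirror m (shiftSeq n a)) ≤ toLex a) (ha0 : m < 2 * a 0)
    {l : ℕ} (hl : 1 ≤ l) (hanti : mirror m (shiftSeq l a) = a)
    (hmin : ∀ n, 1 ≤ n → n < l → mirror m (shiftSeq n a) ≠ a)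
    (hG : l = 1 → (m : ℤ) - a 0 + 1 ≠ a 0) :
    ∃ s t, IsUniqueDigits m q s ∧ IsUniqueDigits m q t ∧
      digitValue q s = digitValue q t + 1 := by
  have hA : ∀ x, a (l + x) = m - a x := fun x => by
    have := congrFun hanti x
    simp only [mirror, shiftSeq] at this; omega
  have hstar : ∀ i < l, ∃ k < l - i,
      (∀ t < k, (m : ℤ) - a (i + t) = a t) ∧ m - a (i + k) < a k := by
    intro i hi
    rcases Nat.eq_zero_or_pos i with rfl | hi0
    · exact ⟨0, by omega, by simp, by rw [add_zero]; omega⟩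
    rcases eq_or_first_lt_of_toLex_le (hmir i hi0) with h | ⟨k, hk, hlt⟩
    · exact absurd h (hmin i hi0 hi)
    refine ⟨k, ?_, hk, hlt⟩
    by_contra! hkl
    have hag : ∀ t < l - i, mirror m (shiftSeq i a) t = a t := fun t ht => hk t (by omega)
    have e : shiftSeq (l - i) (mirror m (shiftSeq i a)) = a := by
      rw [shiftSeq_mirror, shiftSeq_shiftSeq, show i + (l - i) = l by omega, hanti]
    have h1 := shift_toLex_le hag (hmir i hi0)
    rw [e] at h1
    have h2 : a = shiftSeq (l - i) a := toLex.injective (le_antisymm h1 (hle _))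
    exact hmin i hi0 hi (eq_of_shift_eq hag (e.trans h2))
  -- Antiperiodicity places the first difference before `l`. Only a difference of one exactly at the
  -- raised digit can spoil the strict inequality.
  have hR : ∀ r, 1 ≤ r → r < l → toLex (bumpedMirror m l a) < toLex (shiftSeq r a) ∨
      ((∀ t < l - 1, (m : ℤ) - a (r + t) = a t) ∧ (m : ℤ) - a (r - 1) = m - a (l - 1) + 1) := by
    intro r hr hrl
    rcases eq_or_first_lt_of_toLex_le (hmir r hr) with h | ⟨k, hk, hlt⟩
    · exact absurd h (hmin r hr hrl)
    simp only [mirror, shiftSeq] at hk hlt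
    have hkl : k < l := by
      by_contra! hkl
      have h1 := hk (k - l) (by omega)
      have h2 := hA (r + (k - l))
      have h3 := hA (k - l)
      rw [show l + (r + (k - l)) = r + k by omega] at h2
      rw [show l + (k - l) = k by omega] at h3
      omega
    have hpre : ∀ t < k, bumpedMirror m l a t = shiftSeq r a t := fun t ht => by
      have := hk t ht
      rw [bumpedMirror_of_lt (by omega), shiftSeq]; omega
    rcases lt_or_ge k (l - 1) with hk1 | hk1
    · refine Or.inl (toLex_lt_iff.2 ⟨k, hpre, ?_⟩)
      rw [bumpedMirror_of_lt hk1, shiftSeq]; omega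
    · obtain rfl : k = l - 1 := by omega
      rcases lt_or_ge (bumpedMirror m l a (l - 1)) (a (r + (l - 1))) with h1 | h1
      · exact Or.inl (toLex_lt_iff.2 ⟨_, hpre, h1⟩)
      · rw [bumpedMirror_last hl] at h1
        have h2 := hA (r - 1)
        rw [show l + (r - 1) = r + (l - 1) by omega] at h2
        exact Or.inr ⟨hk, by omega⟩
  have hU : ∀ i < l, (∀ t < l - i, bumpedMirror m l a (i + t) = a t) →
      toLex (bumpedMirror m l a) < toLex (shiftSeq (l - i) a) := by
    intro i hi hag
    rcases Nat.eq_zero_or_pos i with rfl | hi0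
    -- A tie over the whole block already fails at the first digit, since m - a 0 < a 0. When `l =
    -- 1` that digit is the raised one, and `hG` is what excludes the tie.
    · exfalso
      have h0 := hag 0 (by omega)
      rcases Nat.eq_or_lt_of_le hl with h1 | h1
      · have := bumpedMirror_last (m := m) (a := a) hl
        rw [← h1] at this h0
        exact hG h1.symm (this.symm.trans h0)
      · rw [bumpedMirror_of_lt (by omega), add_zero] at h0
        omega
    rcases hR (l - i) (by omega) (by omega) with h | ⟨h1, h2⟩
    · exact h
    exfalso
    have h3 := hag (l - i - 1) (by omega)
    rw [show i + (l - i - 1) = l - 1 by omega, bumpedMirror_last hl] at h3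
    rcases Nat.eq_or_lt_of_le (show 1 ≤ l - i by omega) with hr | hr
    · rw [← hr] at h2 h3
      simp only [Nat.sub_self] at h2 h3
      omega
    · have h4 := h1 i (by omega)
      have h5 := hA 0
      have h6 := hag 0 (by omega)
      rw [bumpedMirror_of_lt (by omega)] at h6
      rw [show l - i + i = l + 0 by omega] at h4
      rw [add_zero] at h6
      omega
  have hal : 0 < a (l - 1) := by
    obtain ⟨k, hk, -, hlt⟩ := hstar (l - 1) (by omega)
    obtain rfl : k = 0 := by omega
    have := ha 0
    rw [add_zero] at hlt; omega
  have hw := isDigits_bumpedMirror ha hal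
  have hwt := bumpedMirror_tails hl hle hstar hU
  have hper : shiftSeq (2 * l) a = a := by
    funext x
    have h1 := hA (l + x)
    have h2 := hA x
    rw [shiftSeq, show 2 * l + x = l + (l + x) by omega]; omega
  have hc1 : ∀ i, l ≤ i →
      appendSeq l a (bumpedMirror m l a) i = bumpedMirror m l a (i - l) := fun i hi => by
    rw [appendSeq, if_neg (by omega)]
  refine exists_unique_pair hq ha ha1 hpos (by omega) (N := 2 * l) (by omega) hper hw hwt
    (ha.append hw l) (fun i hi1 hi2 => ?_) (fun i hi => ?_) ?_ ?_
  · rcases lt_or_ge i l with hil | hil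
    · have hsh : shiftSeq (l - i) (shiftSeq i (appendSeq l a (bumpedMirror m l a)))
          = bumpedMirror m l a := by
        rw [shiftSeq_shiftSeq, show i + (l - i) = l by omega, shiftSeq_appendSeq]
      have hpre : ∀ t < l - i, shiftSeq i (appendSeq l a (bumpedMirror m l a)) t = a (i + t) :=
        fun t ht => appendSeq_of_lt _ _ (by omega)
      constructor
      · by_cases hag : ∀ t < l - i, a (i + t) = a t
        · refine toLex_lt_of_shift_lt (r := l - i) (fun t ht => (hpre t ht).trans (hag t ht)) ?_
          rw [hsh]
          rcases hR (l - i) (by omega) (by omega) with h | ⟨-, h2⟩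
          · exact h
          · have h3 := hag (l - i - 1) (by omega)
            rw [show i + (l - i - 1) = l - 1 by omega] at h3
            omega
        · rcases eq_or_first_lt_of_toLex_le (hle i) with h | ⟨k, hk, hlt⟩
          · exact absurd (fun t _ => congrFun h t) hag
          · have hkl : k < l - i := by
              by_contra! hkl
              exact hag fun t ht => hk t (by omega)
            exact toLex_lt_iff.2 ⟨k, fun t ht => (hpre t (by omega)).trans (hk t ht),
              by rw [hpre k hkl]; exact hlt⟩
      · refine lt_of_lt_of_le (mirror_lt_iff.2 ?_) (hmir i hi1)
        refine toLex_lt_of_shift_lt (r := l - i) (fun t ht => (hpre t ht).symm) ?_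
        rw [hsh, shiftSeq_shiftSeq, show i + (l - i) = l by omega]
        refine toLex_lt_iff.2 ⟨l - 1, fun t ht => ?_, ?_⟩
        · rw [bumpedMirror_of_lt ht, shiftSeq, hA]
        · rw [bumpedMirror_last hl, shiftSeq, hA]; omega
    · have := hwt (i - l)
      rwa [← shiftSeq_appendSeq l a (bumpedMirror m l a), shiftSeq_shiftSeq,
        Nat.add_sub_cancel' hil] at this
  · rcases lt_or_ge i l with hil | hil
    · exact appendSeq_of_lt _ _ hil
    · have := hA (i - l)
      rw [Nat.add_sub_cancel' hil] at this
      rw [hc1 i hil, bumpedMirror_of_lt (by omega), this]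
  · have := hA (l - 1)
    rw [show l + (l - 1) = 2 * l - 1 by omega] at this
    rw [hc1 _ (by omega), show 2 * l - 1 - l = l - 1 by omega, bumpedMirror_last hl, this]
  · rw [two_mul, ← shiftSeq_shiftSeq, shiftSeq_appendSeq, shiftSeq_bumpedMirror_self]

lemma eq_goldenRatioGen_of_odd (hq : 1 < q) (h : Odd m) (hG : 2 * q ^ 2 = (m + 1) * (q + 1)) :
    q = goldenRatioGen m := by
  obtain ⟨h0, h1⟩ := goldenRatioGen_of_odd h
  have hm : (0 : ℝ) ≤ m := by positivity
  have h2 : (m : ℝ) + 1 < 2 * q := by nlinarith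
  have h3 : (q - goldenRatioGen m) * (2 * q + 2 * goldenRatioGen m - (m + 1)) = 0 := by nlinarith
  rcases mul_eq_zero.1 h3 with h4 | h4 <;> linarith

/-- An expansion of `1` all of whose tails are admissible yields two points of the univoque set at
distance `1`. -/
lemma exists_unique_pair_of_expansion_one (hq : 1 < q) (hqm : q < m + 1) (ha : IsDigits m a)
    (ha1 : digitValue q a = 1) (hpos : ∀ n, 0 < digitValue q (shiftSeq n a))
    (hle1 : ∀ n, digitValue q (shiftSeq n a) ≤ 1)
    (hge : ∀ n, 0 < a n → m / (q - 1) - 1 ≤ digitValue q (shiftSeq (n + 1) a))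
    (hG : q ≠ goldenRatioGen m) :
    ∃ s t, IsUniqueDigits m q s ∧ IsUniqueDigits m q t ∧
      digitValue q s = digitValue q t + 1 := by
  have hq1 : 0 < q - 1 := by linarith
  have hM : 1 < (m : ℝ) / (q - 1) := by rw [lt_div_iff₀ hq1]; linarith
  have hMq : m / (q - 1) * (q - 1) = (m : ℝ) := by field_simp
  have ha0 : 0 < a 0 := by
    have e := mul_digitValue hq ha
    have := hle1 1
    have h : (0 : ℝ) < a 0 := by rw [ha1] at e; linarith
    exact_mod_cast h
  have hge' : ∀ n, 1 ≤ n → m / (q - 1) - 1 ≤ digitValue q (shiftSeq n a) := by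
    intro n hn
    induction n, hn using Nat.le_induction with
    | base => exact hge 0 ha0
    | succ n hn ih =>
      rcases (ha n).1.eq_or_lt with h0 | h0
      · have e := mul_digitValue_shift hq ha n
        rw [← h0] at e
        push_cast at e
        nlinarith
      · exact hge n h0
  have hle : ∀ n, toLex (shiftSeq n a) ≤ toLex a := fun n =>
    toLex_le_of_digitValue_le_one hq ha ha1 hle1 (ha.shift n) (hle1 n) fun k => by
      rw [shiftSeq_shiftSeq]; exact hpos _
  have hmir : ∀ n, 1 ≤ n → toLex (mirror m (shiftSeq n a)) ≤ toLex a := fun n hn =>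
    toLex_le_of_digitValue_le_one hq ha ha1 hle1 (ha.shift n).mirror
      (by rw [digitValue_mirror hq (ha.shift n)]; linarith [hge' n hn]) fun k => by
        rw [shiftSeq_mirror, shiftSeq_shiftSeq, digitValue_mirror hq (ha.shift _)]
        linarith [hle1 (n + k)]
  have hdle : ∀ n, a n ≤ a 0 := fun n => apply_zero_le_of_toLex_le (hle n)
  have hdge : ∀ n, 1 ≤ n → m - a n ≤ a 0 := fun n hn => apply_zero_le_of_toLex_le (hmir n hn)
  have hm2 : (m : ℤ) < 2 * a 0 := by
    have h1 := hdle 1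
    have h2 := hdge 1 le_rfl
    -- Equality makes `a` constantly m/2, so q = 1 + m/2, the even golden ratio.
    refine lt_of_le_of_ne (by omega) fun heq => hG ?_
    have hc : a = fun _ => a 0 := funext fun n => by
      rcases Nat.eq_zero_or_pos n with rfl | hn
      · rfl
      · have := hdle n
        have := hdge n hn
        omega
    have he : Even m := by
      have : Even (m : ℤ) := ⟨a 0, by omega⟩
      exact_mod_cast this
    have hv := digitValue_const (m := m) hq (ha 0).1 (ha 0).2
    rw [← hc, ha1, eq_div_iff hq1.ne'] at hv
    have := goldenRatioGen_of_even he
    have heq' : (m : ℝ) = 2 * a 0 := by exact_mod_cast heq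
    linarith
  classical
  by_cases hB : ∃ n, 1 ≤ n ∧ mirror m (shiftSeq n a) = a
  · have hl := Nat.find_spec hB
    have hmin : ∀ n, 1 ≤ n → n < Nat.find hB → mirror m (shiftSeq n a) ≠ a := fun n h1 h2 h3 =>
      Nat.find_min hB h2 ⟨h1, h3⟩
    refine exists_unique_pair_of_antiperiodic hq ha ha1 hpos hle hmir hm2 hl.1 hl.2 hmin
      fun h1 h2 => hG ?_
    have h3 := hl.2
    rw [h1] at h3
    have h4 := mul_digitValue hq ha
    have h5 := digitValue_mirror hq (ha.shift 1)
    rw [h3, ha1] at h5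
    rw [ha1, mul_one] at h4
    have ho : Odd m := by
      have : Odd (m : ℤ) := ⟨a 0 - 1, by omega⟩
      exact_mod_cast this
    have h6 : (m : ℝ) + 1 = 2 * a 0 := by
      have : (m : ℤ) + 1 = 2 * a 0 := by omega
      exact_mod_cast this
    refine eq_goldenRatioGen_of_odd hq ho ?_
    have h7 : m / (q - 1) = q - a 0 + 1 := by linarith
    rw [h7] at hMq
    have h8 : (a 0 : ℝ) = (m + 1) / 2 := by linarith
    rw [h8] at hMq
    linarith
  · push Not at hB
    have hmir' : ∀ n, 1 ≤ n → toLex (mirror m (shiftSeq n a)) < toLex a := fun n hn =>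
      lt_of_le_of_ne (hmir n hn) fun h => hB n hn (toLex.injective h)
    by_cases hP : ∃ n, 1 ≤ n ∧ shiftSeq n a = a
    · have hN := Nat.find_spec hP
      exact exists_unique_pair_of_periodic hq hqm ha ha1 hpos hle1 hle hmir' ha0 hN.1 hN.2
        fun n h1 h2 h3 => Nat.find_min hP h2 ⟨h1, h3⟩
    · push Not at hP
      refine ⟨a, fun _ => 0, .of_lex hq ha ha1 hpos ha (fun n _ => ?_) (fun n _ => hmir' _ (by omega)),
        isUniqueDigits_zero hq, ?_⟩
      · exact lt_of_le_of_ne (hle _) fun h => hP (n + 1) (by omega) (toLex.injective h)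
      · rw [digitValue_const (m := m) hq le_rfl (by positivity), ha1]; simp

/-- A point of `V_q` outside `U_q` has, as a tail of its expansion or of the mirror image of it, an
expansion of `1` with admissible tails. -/
lemma exists_expansion_one (hq : 1 < q) (hqm : q < m + 1) {y : ℝ} (hy : y ∈ doublySet m q)
    (hyU : y ∉ univoqueSet m q) :
    ∃ a, IsDigits m a ∧ digitValue q a = 1 ∧ (∀ n, 0 < digitValue q (shiftSeq n a)) ∧
      (∀ n, digitValue q (shiftSeq n a) ≤ 1) ∧
      ∀ n, 0 < a n → m / (q - 1) - 1 ≤ digitValue q (shiftSeq (n + 1) a) := by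
  have hq1 : 0 < q - 1 := by linarith
  have hM : 1 < (m : ℝ) / (q - 1) := by rw [lt_div_iff₀ hq1]; linarith
  rw [mem_doublySet_iff hq] at hy
  obtain ⟨⟨hy0, hy1⟩, hu⟩ := hy
  rw [univoqueSet_eq hq] at hyU
  have hy0' : 0 < y := lt_of_le_of_ne hy0 fun h => hyU ⟨_, isUniqueDigits_zero hq, by
    rw [digitValue_const (m := m) hq le_rfl (by positivity), ← h]; simp⟩
  have hy1' : y < m / (q - 1) := lt_of_le_of_ne hy1 fun h => hyU ⟨_, isUniqueDigits_max hq, by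
    rw [digitValue_const (m := m) hq (by positivity) le_rfl, h]; simp⟩
  have hdbl : ∀ s, IsDigits m s →
      (∀ n, 0 < digitValue q (shiftSeq n s)) →
      (∀ n, s n < m → digitValue q (shiftSeq (n + 1) s) ≤ 1) → IsDoublyInfiniteDigits m s := by
    intro s hs hp hl
    constructor
    · intro n _
      by_contra! hz
      have : shiftSeq (n + 1) s = fun _ => 0 := funext fun i => hz _ (by omega)
      have h1 := hp (n + 1)
      rw [this, digitValue_const (m := m) hq le_rfl (by positivity)] at h1
      simp at h1
    · intro n hn
      by_contra! hz
      have : shiftSeq (n + 1) s = fun _ => (m : ℤ) := funext fun i => hz _ (by omega)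
      have h1 := hl n (lt_of_le_of_ne (hs n).2 hn)
      rw [this, digitValue_const (m := m) hq (by positivity) le_rfl, Int.cast_natCast] at h1
      linarith
  obtain ⟨s, hs, hsv, hsp, hsl⟩ := exists_quasiGreedy hq hqm.le hy0' hy1
  obtain ⟨t, ht, htv, htp, htl⟩ := exists_quasiGreedy hq hqm.le (y := m / (q - 1) - y)
    (by linarith) (by linarith)
  -- The mirror image of the quasi-greedy expansion of M - y is the quasi-lazy expansion of y. Both
  -- expansions of y are doubly infinite, so they agree.
  have hst : s = mirror m t := hu s (mirror m t) hs ht.mirror hsv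
    (by rw [digitValue_mirror hq ht, htv]; ring) (hdbl s hs hsp hsl)
    (hdbl t ht htp htl).mirror
  have hts : t = mirror m s := by rw [hst, mirror_mirror]
  -- Stated for both orders of the pair: failure of uniqueness means that `s` or its mirror has a
  -- tail of value exactly 1 after a digit below `m`.
  have extract : ∀ s t : ℕ → ℤ, IsDigits m s → IsDigits m t → t = mirror m s →
      (∀ n, 0 < digitValue q (shiftSeq n s)) →
      (∀ n, s n < m → digitValue q (shiftSeq (n + 1) s) ≤ 1) →
      (∀ n, t n < m → digitValue q (shiftSeq (n + 1) t) ≤ 1) →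
      (∃ n, s n < m ∧ 1 ≤ digitValue q (shiftSeq (n + 1) s)) →
      ∃ a, IsDigits m a ∧ digitValue q a = 1 ∧ (∀ n, 0 < digitValue q (shiftSeq n a)) ∧
        (∀ n, digitValue q (shiftSeq n a) ≤ 1) ∧
        ∀ n, 0 < a n → m / (q - 1) - 1 ≤ digitValue q (shiftSeq (n + 1) a) := by
    rintro s t hs ht rfl hsp hsl htl ⟨n, hn, hn1⟩
    refine ⟨shiftSeq (n + 1) s, hs.shift _, le_antisymm (hsl n hn) hn1,
      fun k => by rw [shiftSeq_shiftSeq]; exact hsp _, fun k => ?_, fun k hk => ?_⟩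
    · induction k with
      | zero => rw [shiftSeq_zero]; exact hsl n hn
      | succ k ih =>
        rcases (hs (n + 1 + k)).2.lt_or_eq with h | h
        · rw [shiftSeq_shiftSeq]; exact hsl _ h
        · have e := mul_digitValue_shift hq (hs.shift (n + 1)) k
          have h' : shiftSeq (n + 1) s k = m := h
          rw [h', Int.cast_natCast] at e
          nlinarith
    · have h := htl (n + 1 + k) (by simp only [mirror, shiftSeq] at hk ⊢; omega)
      rw [shiftSeq_mirror, digitValue_mirror hq (hs.shift _)] at h
      rw [shiftSeq_shiftSeq, ← add_assoc]
      linarith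
  by_cases h1 : ∃ n, s n < m ∧ 1 ≤ digitValue q (shiftSeq (n + 1) s)
  · exact extract s t hs ht hts hsp hsl htl h1
  by_cases h2 : ∃ n, t n < m ∧ 1 ≤ digitValue q (shiftSeq (n + 1) t)
  · exact extract t s ht hs hst htp htl hsl h2
  push Not at h1 h2
  refine absurd ⟨s, IsUniqueDigits.of_tails hq hs h1 fun n hn => ?_, hsv⟩ hyU
  have h := h2 n (by rw [hts]; simp only [mirror]; omega)
  rw [hts, shiftSeq_mirror, digitValue_mirror hq (hs.shift _)] at h
  linarith

lemma one_mem_univoque_sub_of_doubly (hq : q ∈ Ioc (1 : ℝ) (m + 1))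
    (h : (1 : ℝ) ∈ doublySet m q - doublySet m q) (hG : q ≠ goldenRatioGen m) :
    (1 : ℝ) ∈ univoqueSet m q - univoqueSet m q := by
  obtain ⟨hq1, hqm⟩ := hq
  rcases hqm.eq_or_lt with heq | hlt
  · rw [one_mem_univoque_sub_iff hq1]
    refine ⟨_, _, isUniqueDigits_max hq1, isUniqueDigits_zero hq1, ?_⟩
    rw [digitValue_const (m := m) hq1 (by positivity) le_rfl,
      digitValue_const (m := m) hq1 le_rfl (by positivity), Int.cast_natCast, Int.cast_zero, zero_div,
      zero_add, div_eq_one_iff_eq (by linarith)]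
    linarith
  · obtain ⟨y, hy, z, hz, hyz⟩ := Set.mem_sub.1 h
    by_cases hU : y ∈ univoqueSet m q ∧ z ∈ univoqueSet m q
    · exact Set.mem_sub.2 ⟨y, hU.1, z, hU.2, hyz⟩
    · obtain ⟨x, hx, hxU⟩ : ∃ x, x ∈ doublySet m q ∧ x ∉ univoqueSet m q := by
        by_cases h1 : y ∈ univoqueSet m q
        · exact ⟨z, hz, fun h2 => hU ⟨h1, h2⟩⟩
        · exact ⟨y, hy, h1⟩
      obtain ⟨a, ha, ha1, hpos, hle1, hge⟩ := exists_expansion_one hq1 hlt hx hxU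
      exact (one_mem_univoque_sub_iff hq1).2
        (exists_unique_pair_of_expansion_one hq1 hlt ha ha1 hpos hle1 hge hG)

end Construction

theorem theorem1p1 (m : ℕ) (hm : 1 ≤ m) (q : ℝ) (hq : q ∈ Set.Ioc (1 : ℝ) ((m : ℝ) + 1)) :
    List.TFAE
      [q ∈ basesTwo m,
       (1 : ℝ) ∈ univoqueSet m q - univoqueSet m q,
       (1 : ℝ) ∈ closure (univoqueSet m q) - closure (univoqueSet m q),
       (1 : ℝ) ∈ doublySet m q - doublySet m q ∧ q ≠ goldenRatioGen m] := by
  tfae_have 1 → 2 := one_mem_univoque_sub_of_mem_basesTwo hq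
  tfae_have 2 → 1 := mem_basesTwo_of_one_mem_univoque_sub hm hq
  tfae_have 2 → 3 := fun h => Set.sub_subset_sub subset_closure subset_closure h
  tfae_have 3 → 4 := fun h => ⟨Set.sub_subset_sub (closure_univoqueSet_subset hq)
    (closure_univoqueSet_subset hq) h, ne_goldenRatioGen_of_mem hm hq h⟩
  tfae_have 4 → 2 := fun h => one_mem_univoque_sub_of_doubly hq h.1 h.2
  tfae_finish
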